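/- Let $D>0$, $R>0$, $a\in\mathbb{R}$ with $\frac{aR}{D}\in(0,e^{-1}]$. Let $\Phi\in L^\infty_{\mathrm{loc}}([0,\infty))$ be of at most exponential order (there are $M\ge 0$, $\gamma\in\mathbb{R}$ with $|\Phi(t)|\le Me^{\gamma t}$ for a.e. $t\ge 0$) with $\Phi(t)\ge 0$ for a.e. $t\ge 0$, and let $u_0\in H^1(\mathbb{R})$ be real-valued with $u_0\ge 0$. Consider the problem $$\partial_t u = D\,\partial_x^2 u+\Psi_t[u]\,\delta_0\quad (t>0,\ x\in\mathbb{R}),\qquad u(0,\cdot)=u_0,\qquad \Psi_t[u]:=\Phi(t)-a\bigl[u(t,-R)+u(t,R)\bigr].$$ A mild solution is a continuous map $u:[0,\infty)\to H^1(\mathbb{R})$ with $u(0)=u_0$ such that, for every $t>0$, $$u(t)=e^{tD\Delta}u_0+\int_0^t \Psi_\tau[u]\,e^{(t-\tau)D\Delta}\delta_0\,\mathrm{d}\tau ,$$ where the integral is a Bochner integral in $H^1(\mathbb{R})$, $e^{s\Delta}$ ($s>0$) is convolution with the heat kernel $\frac{1}{\sqrt{4\pi s}}e^{-x^2/(4s)}$,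 so that $e^{s\Delta}\delta_0$ is this kernel, and elements of $H^1(\mathbb{R})$ are identified with their continuous representatives. If $u_0(-x)=u_0(x)$ for all $x\in\mathbb{R}\smallsetminus(-\frac R2,\frac R2)$, then the mild solution $u$ satisfies $u(t,x)\ge 0$ for all $t\ge 0$ and all $x\in\mathbb{R}\smallsetminus(-R,R)$. -/

import Mathlib

open MeasureTheory Set Filter Topology
open scoped ENNReal ContDiff

/-- `g` is a weak (distributional) derivative of `f` on the real line. -/
def HasWeakDeriv (f g : ℝ → ℝ) : Prop :=
  ∀ φ : ℝ → ℝ, ContDiff ℝ ∞ φ → HasCompactSupport φ →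
    ∫ x, f x * deriv φ x = -∫ x, g x * φ x

/-- Test functions are in every `L^p`. -/
theorem memLp_of_test {φ : ℝ → ℝ} (h : ContDiff ℝ ∞ φ) (hc : HasCompactSupport φ) :
    MemLp φ 2 (volume : Measure ℝ) :=
  h.continuous.memLp_of_hasCompactSupport hc

theorem memLp_deriv_of_test {φ : ℝ → ℝ} (h : ContDiff ℝ ∞ φ) (hc : HasCompactSupport φ) :
    MemLp (deriv φ) 2 (volume : Measure ℝ) :=
  (h.continuous_deriv (by simp)).memLp_of_hasCompactSupport hc.deriv

theorem lp_mul_integrable {φ : ℝ → ℝ} (hφ : MemLp φ 2 (volume : Measure ℝ))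
    (f : Lp ℝ 2 (volume : Measure ℝ)) : Integrable (fun x => f x * φ x) :=
  (Lp.memLp f).integrable_mul hφ

theorem lp_inner_toLp {φ : ℝ → ℝ} (hφ : MemLp φ 2 (volume : Measure ℝ))
    (f : Lp ℝ 2 (volume : Measure ℝ)) :
    inner ℝ (hφ.toLp φ) f = ∫ x, f x * φ x := by
  rw [L2.inner_def]
  refine integral_congr_ae ?_
  filter_upwards [hφ.coeFn_toLp] with x hx
  rw [hx]
  rfl

/-- A pair of `L²` functions satisfies the weak derivative relation iff it is annihilated by all
the functionals coming from test functions. -/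
theorem hasWeakDeriv_iff (f g : Lp ℝ 2 (volume : Measure ℝ)) :
    HasWeakDeriv f g ↔ ∀ (φ : ℝ → ℝ) (h : ContDiff ℝ ∞ φ) (hc : HasCompactSupport φ),
      inner ℝ ((memLp_deriv_of_test h hc).toLp (deriv φ)) f
        + inner ℝ ((memLp_of_test h hc).toLp φ) g = 0 := by
  simp only [lp_inner_toLp, HasWeakDeriv, ← eq_neg_iff_add_eq_zero]

/-- The Sobolev space `H¹(ℝ)`, realised as the space of pairs `(f, f')` of functions in `L²(ℝ)`
where `f'` is the weak derivative of `f`.  The norm inherited from the `ℓ²`-product `L² × L²` is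
the usual one, `‖f‖² = ‖f‖²_{L²} + ‖f'‖²_{L²}`. -/
def sobolevH1 : Submodule ℝ
    (WithLp 2 (Lp ℝ 2 (volume : Measure ℝ) × Lp ℝ 2 (volume : Measure ℝ))) where
  carrier := {p | HasWeakDeriv p.fst p.snd}
  zero_mem' := by
    simp only [mem_ofPred_eq, hasWeakDeriv_iff]
    intro φ h hc
    simp
  add_mem' := by
    intro p q hp hq
    simp only [mem_ofPred_eq, hasWeakDeriv_iff] at hp hq ⊢
    intro φ h hc
    simp only [WithLp.add_fst, WithLp.add_snd, inner_add_right]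
    linarith [hp φ h hc, hq φ h hc]
  smul_mem' := by
    intro c p hp
    simp only [mem_ofPred_eq, hasWeakDeriv_iff] at hp ⊢
    intro φ h hc
    simp only [WithLp.smul_fst, WithLp.smul_snd, inner_smul_right]
    rw [← mul_add, hp φ h hc, mul_zero]

/-- The Hilbert space `H¹(ℝ)`. -/
abbrev H1 : Type := sobolevH1

theorem isClosed_sobolevH1 : IsClosed (sobolevH1 : Set
    (WithLp 2 (Lp ℝ 2 (volume : Measure ℝ) × Lp ℝ 2 (volume : Measure ℝ)))) := by
  have : (sobolevH1 : Set
      (WithLp 2 (Lp ℝ 2 (volume : Measure ℝ) × Lp ℝ 2 (volume : Measure ℝ)))) =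
      ⋂ (φ : ℝ → ℝ) (h : ContDiff ℝ ∞ φ) (hc : HasCompactSupport φ),
        {p | inner ℝ ((memLp_deriv_of_test h hc).toLp (deriv φ)) p.fst
          + inner ℝ ((memLp_of_test h hc).toLp φ) p.snd = 0} := by
    ext p
    simp only [mem_iInter, mem_ofPred_eq]
    exact hasWeakDeriv_iff p.fst p.snd
  rw [this]
  refine isClosed_iInter fun φ => isClosed_iInter fun h => isClosed_iInter fun hc => ?_
  refine isClosed_eq ?_ continuous_const
  have h1 : Continuous fun p : WithLp 2 (Lp ℝ 2 (volume : Measure ℝ) ×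
      Lp ℝ 2 (volume : Measure ℝ)) => p.fst :=
    continuous_fst.comp (WithLp.prod_continuous_ofLp 2 _ _)
  have h2 : Continuous fun p : WithLp 2 (Lp ℝ 2 (volume : Measure ℝ) ×
      Lp ℝ 2 (volume : Measure ℝ)) => p.snd :=
    continuous_snd.comp (WithLp.prod_continuous_ofLp 2 _ _)
  exact (continuous_const.inner h1).add (continuous_const.inner h2)

instance : CompleteSpace H1 := isClosed_sobolevH1.completeSpace_coe

/-- A locally integrable function with vanishing weak derivative is a.e. constant. -/
theorem ae_const_of_weakDeriv_zero {h : ℝ → ℝ} (hloc : LocallyIntegrable h)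
    (hz : ∀ φ : ℝ → ℝ, ContDiff ℝ ∞ φ → HasCompactSupport φ → ∫ x, h x * deriv φ x = 0) :
    ∃ c : ℝ, ∀ᵐ x, h x = c := by
  have hint : ∀ φ : ℝ → ℝ, ContDiff ℝ ∞ φ → HasCompactSupport φ →
      Integrable (fun x => h x * φ x) := by
    intro φ hφ hc
    have := hloc.integrable_smul_left_of_hasCompactSupport hφ.continuous hc
    simpa [mul_comm] using this
  let b : ContDiffBump (0 : ℝ) := ⟨1, 2, one_pos, one_lt_two⟩
  let ρ : ℝ → ℝ := b.normed volume
  have hρ : ContDiff ℝ ∞ ρ := b.contDiff_normed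
  have hρc : HasCompactSupport ρ := b.hasCompactSupport_normed
  have hρ1 : ∫ x, ρ x = 1 := b.integral_normed
  refine ⟨∫ x, h x * ρ x, ?_⟩
  set c := ∫ x, h x * ρ x with hcdef
  refine ae_eq_of_integral_contDiff_smul_eq hloc (locallyIntegrable_const c) ?_
  intro ψ hψ hψc
  set m := ∫ x, ψ x with hm
  let η : ℝ → ℝ := fun x => ψ x - m * ρ x
  have hη : ContDiff ℝ ∞ η := hψ.sub (contDiff_const.mul hρ)
  have hηc : HasCompactSupport η := hψc.sub hρc.mul_left
  have hηi : Integrable η := hη.continuous.integrable_of_hasCompactSupport hηc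
  have hψi : Integrable ψ := hψ.continuous.integrable_of_hasCompactSupport hψc
  have hρi : Integrable ρ := hρ.continuous.integrable_of_hasCompactSupport hρc
  have hη0 : ∫ x, η x = 0 := by
    simp only [η]
    rw [integral_sub hψi (hρi.const_mul m), integral_const_mul, hρ1, ← hm]; ring
  obtain ⟨A, hA⟩ : ∃ A : ℝ, ∀ x, A ≤ |x| → η x = 0 := by
    obtain ⟨A, hA⟩ := hηc.isCompact.isBounded.subset_closedBall (0 : ℝ)
    refine ⟨A + 1, fun x hx => ?_⟩
    by_contra hne
    have := hA (subset_tsupport _ (Function.mem_support.2 hne))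
    rw [mem_closedBall_zero_iff, Real.norm_eq_abs] at this
    linarith
  let Φ : ℝ → ℝ := fun x => ∫ y in (-A)..x, η y
  have hΦd : ∀ x, HasDerivAt Φ (η x) x := fun x =>
    hη.continuous.integral_hasStrictDerivAt _ x |>.hasDerivAt
  have hΦ' : deriv Φ = η := funext fun x => (hΦd x).deriv
  have hΦs : ContDiff ℝ ∞ Φ := by
    rw [contDiff_infty_iff_deriv, hΦ']
    exact ⟨fun x => (hΦd x).differentiableAt, hη⟩
  have hzero : ∀ x y, x ≤ y → (∀ z, z ∈ Ioc x y → η z = 0) → ∫ z in x..y, η z = 0 := by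
    intro x y hxy hz
    rw [intervalIntegral.integral_of_le hxy]
    exact setIntegral_eq_zero_of_forall_eq_zero hz
  have hΦc : HasCompactSupport Φ := by
    refine HasCompactSupport.intro (isCompact_closedBall (0 : ℝ) |A|) fun x hx => ?_
    rw [mem_closedBall_zero_iff, Real.norm_eq_abs, not_le] at hx
    rcases le_or_gt 0 x with h0 | h0
    · rw [abs_of_nonneg h0] at hx
      have h2 : ∫ y in Ioi x, η y = 0 := by
        refine setIntegral_eq_zero_of_forall_eq_zero fun y hy => hA y ?_
        have : x < y := hy
        linarith [le_abs_self A, le_abs_self y]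
      have h3 : ∫ y in Iic (-A), η y = 0 := by
        rw [integral_Iic_eq_integral_Iio]
        refine setIntegral_eq_zero_of_forall_eq_zero fun y hy => hA y ?_
        have : y < -A := hy
        linarith [neg_abs_le y]
      have h4 := intervalIntegral.integral_Iic_sub_Iic (a := -A) (b := x)
        hηi.integrableOn hηi.integrableOn
      have h5 := intervalIntegral.integral_Iic_add_Ioi (b := x)
        hηi.integrableOn hηi.integrableOn
      simp only [Φ]
      rw [← h4]
      linarith
    · rw [abs_of_neg h0] at hx
      have hxA : x ≤ -A := by linarith [le_abs_self A]
      simp only [Φ]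
      rw [intervalIntegral.integral_symm]
      rw [intervalIntegral.integral_of_le hxA, integral_Ioc_eq_integral_Ioo,
        setIntegral_eq_zero_of_forall_eq_zero, neg_zero]
      intro y hy
      refine hA y ?_
      linarith [hy.2, neg_abs_le y]
  have key := hz Φ hΦs hΦc
  rw [hΦ'] at key
  have e1 : ∫ x, h x * η x = (∫ x, h x * ψ x) - m * c := by
    have : (fun x => h x * η x) = fun x => h x * ψ x - m * (h x * ρ x) := by
      funext x; simp only [η]; ring
    rw [this, integral_sub (hint ψ hψ hψc) ((hint ρ hρ hρc).const_mul m), integral_const_mul]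
  rw [e1] at key
  have e2 : ∫ x, ψ x • c = m * c := by
    simp only [smul_eq_mul]; rw [integral_mul_const]
  rw [e2]
  simp only [smul_eq_mul, mul_comm (ψ _)]
  linarith

/-- One-dimensional Sobolev embedding: every element of `H¹(ℝ)` has a continuous
representative. -/
theorem H1.exists_continuous_rep (f : H1) :
    ∃ F : ℝ → ℝ, Continuous F ∧ (f.1.fst : ℝ → ℝ) =ᵐ[volume] F := by
  let g : ℝ → ℝ := ⇑f.1.snd
  have hgl : LocallyIntegrable g := (Lp.memLp f.1.snd).locallyIntegrable (by norm_num)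
  have hfl : LocallyIntegrable (f.1.fst : ℝ → ℝ) :=
    (Lp.memLp f.1.fst).locallyIntegrable (by norm_num)
  have hgi : ∀ a b, IntervalIntegrable g volume a b := fun a b =>
    (hgl.integrableOn_isCompact isCompact_uIcc).intervalIntegrable
  let G : ℝ → ℝ := fun x => ∫ y in (0 : ℝ)..x, g y
  have hG : Continuous G := intervalIntegral.continuous_primitive hgi 0
  have hGw : ∀ φ : ℝ → ℝ, ContDiff ℝ ∞ φ → HasCompactSupport φ →
      ∫ x, G x * deriv φ x = -∫ x, g x * φ x := by
    intro φ hφ hφc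
    obtain ⟨A, hA0, hA⟩ : ∃ A : ℝ, 0 < A ∧ ∀ x, A ≤ |x| → φ x = 0 ∧ deriv φ x = 0 := by
      obtain ⟨A, hA⟩ := hφc.isCompact.isBounded.subset_closedBall (0 : ℝ)
      refine ⟨|A| + 1, by positivity, fun x hx => ?_⟩
      have hx' : x ∉ tsupport φ := fun hmem => by
        have := hA hmem
        rw [mem_closedBall_zero_iff, Real.norm_eq_abs] at this
        linarith [le_abs_self A]
      exact ⟨image_eq_zero_of_notMem_tsupport hx', image_eq_zero_of_notMem_tsupport
        fun h => hx' (tsupport_deriv_subset h)⟩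
    have hle : -A ≤ A := by linarith
    have red : ∀ k : ℝ → ℝ, (∀ x, A ≤ |x| → k x = 0) → ∫ x, k x = ∫ x in (-A)..A, k x := by
      intro k hk
      rw [intervalIntegral.integral_of_le hle, setIntegral_eq_integral_of_forall_compl_eq_zero]
      intro x hx
      apply hk
      by_contra hlt
      rw [not_le, abs_lt] at hlt
      exact hx ⟨hlt.1, hlt.2.le⟩
    rw [red _ fun x hx => by rw [(hA x hx).2, mul_zero],
      red _ fun x hx => by rw [(hA x hx).1, mul_zero]]
    have acG : AbsolutelyContinuousOnInterval G (-A) A :=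
      (hgi (-A) A).absolutelyContinuousOnInterval_intervalIntegral
        (by rw [uIcc_of_le hle]; constructor <;> linarith)
    have acφ : AbsolutelyContinuousOnInterval φ (-A) A :=
      ((hφ.of_le (by simp)).contDiffOn).absolutelyContinuousOnInterval
    have ibp := acG.integral_mul_deriv_eq_deriv_mul acφ
    rw [ibp, (hA A (le_abs_self A)).1, (hA (-A) (by simp [le_abs_self])).1]
    have : ∫ x in (-A)..A, deriv G x * φ x = ∫ x in (-A)..A, g x * φ x := by
      refine intervalIntegral.integral_congr_ae ?_
      have := LocallyIntegrable.ae_hasDerivAt_integral hgl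
      filter_upwards [this] with x hx _
      rw [(hx 0).deriv]
    rw [this]; ring
  obtain ⟨c, hc⟩ := ae_const_of_weakDeriv_zero (h := fun x => f.1.fst x - G x)
    (hfl.sub hG.locallyIntegrable) (by
      intro φ hφ hφc
      have i1 := lp_mul_integrable (memLp_deriv_of_test hφ hφc) f.1.fst
      have i2 : Integrable fun x => G x * deriv φ x :=
        (hG.mul (hφ.continuous_deriv (by simp))).integrable_of_hasCompactSupport
          hφc.deriv.mul_left
      simp only [sub_mul]
      rw [integral_sub i1 i2, hGw φ hφ hφc]
      have := f.2 φ hφ hφc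
      rw [this, sub_self])
  refine ⟨fun x => c + G x, continuous_const.add hG, ?_⟩
  filter_upwards [hc] with x hx
  linarith

/-- The continuous representative of an element of `H¹(ℝ)` (it is unique, since two continuous
functions that agree almost everywhere are equal).  Point values `f(x)` of `f ∈ H¹(ℝ)` are the
values of this function. -/
noncomputable def H1.rep (f : H1) : ℝ → ℝ := f.exists_continuous_rep.choose

theorem H1.continuous_rep (f : H1) : Continuous f.rep := f.exists_continuous_rep.choose_spec.1

theorem H1.coeFn_ae_eq_rep (f : H1) : (f.1.fst : ℝ → ℝ) =ᵐ[volume] f.rep :=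
  f.exists_continuous_rep.choose_spec.2

/-- The heat kernel `exp(-x²/(4s)) / √(4πs)` on the line, for `s > 0`.  For `s ≤ 0` the formula
evaluates to `0`. -/
noncomputable def heatKernel (s x : ℝ) : ℝ :=
  Real.exp (-x ^ 2 / (4 * s)) / √(4 * Real.pi * s)

theorem heatKernel_of_nonpos {s : ℝ} (hs : s ≤ 0) (x : ℝ) : heatKernel s x = 0 := by
  have : √(4 * Real.pi * s) = 0 :=
    Real.sqrt_eq_zero_of_nonpos (mul_nonpos_of_nonneg_of_nonpos (by positivity) hs)
  simp [heatKernel, this]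

theorem hasDerivAt_heatKernel (s x : ℝ) :
    HasDerivAt (heatKernel s) (-(2 * x) / (4 * s) * heatKernel s x) x := by
  unfold heatKernel
  have h0 : HasDerivAt (fun y : ℝ => -y ^ 2 / (4 * s)) (-(2 * x) / (4 * s)) x := by
    simpa using ((hasDerivAt_pow 2 x).fun_neg).div_const (4 * s)
  have h := h0.exp.div_const (√(4 * Real.pi * s))
  rwa [mul_comm (Real.exp _), mul_div_assoc] at h

theorem memLp_heatKernel (s : ℝ) : MemLp (heatKernel s) 2 (volume : Measure ℝ) := by
  rcases le_or_gt s 0 with hs | hs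
  · have : heatKernel s = 0 := funext fun x => heatKernel_of_nonpos hs x
    rw [this]; exact MemLp.zero
  · have hc : Continuous (heatKernel s) :=
      continuous_iff_continuousAt.2 fun x => (hasDerivAt_heatKernel s x).continuousAt
    rw [memLp_two_iff_integrable_sq hc.aestronglyMeasurable]
    have := (integrable_exp_neg_mul_sq (b := 1 / (2 * s)) (by positivity)).const_mul
      ((√(4 * Real.pi * s))⁻¹ ^ 2)
    refine this.congr (ae_of_all _ fun x => ?_)
    simp only [heatKernel]
    have e : ((2 : ℕ) : ℝ) * (-x ^ 2 / (4 * s)) = -(1 / (2 * s)) * x ^ 2 := by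
      push_cast; field_simp; ring
    rw [div_pow, ← Real.exp_nat_mul, e, inv_pow, mul_comm]
    exact (div_eq_mul_inv _ _).symm

theorem memLp_deriv_heatKernel (s : ℝ) :
    MemLp (deriv (heatKernel s)) 2 (volume : Measure ℝ) := by
  have hd : deriv (heatKernel s) = fun x => -(2 * x) / (4 * s) * heatKernel s x :=
    funext fun x => (hasDerivAt_heatKernel s x).deriv
  rcases le_or_gt s 0 with hs | hs
  · have : deriv (heatKernel s) = 0 := by
      rw [hd]; funext x; simp [heatKernel_of_nonpos hs]
    rw [this]; exact MemLp.zero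
  · have hc : Continuous (heatKernel s) :=
      continuous_iff_continuousAt.2 fun x => (hasDerivAt_heatKernel s x).continuousAt
    have hc' : Continuous (deriv (heatKernel s)) := by
      rw [hd]; fun_prop
    rw [memLp_two_iff_integrable_sq hc'.aestronglyMeasurable]
    have := (integrable_rpow_mul_exp_neg_mul_sq (b := 1 / (2 * s)) (by positivity)
      (s := 2) (by norm_num)).const_mul (1 / (4 * s ^ 2) * (√(4 * Real.pi * s))⁻¹ ^ 2)
    refine this.congr (ae_of_all _ fun x => ?_)
    rw [hd]
    simp only [heatKernel]
    rw [mul_pow, div_pow (Real.exp _), ← Real.exp_nat_mul, inv_pow]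
    have : ((2 : ℕ) : ℝ) * (-x ^ 2 / (4 * s)) = -(1 / (2 * s)) * x ^ 2 := by
      push_cast; field_simp; ring
    rw [this, Real.rpow_ofNat]
    field_simp
    norm_num [mul_comm]

/-- The heat kernel as an element of `H¹(ℝ)`.  For `s > 0` this is `e^{sΔ} δ₀`, the
result of applying the heat semigroup to the Dirac measure at the origin. -/
noncomputable def heatKernelH1 (s : ℝ) : H1 :=
  ⟨WithLp.toLp 2 ((memLp_heatKernel s).toLp _, (memLp_deriv_heatKernel s).toLp _), by
    intro φ hφ hφc
    have e1 : ∫ x, ((memLp_heatKernel s).toLp _ : ℝ → ℝ) x * deriv φ x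
        = ∫ x, heatKernel s x * deriv φ x := by
      refine integral_congr_ae ?_
      filter_upwards [(memLp_heatKernel s).coeFn_toLp] with x hx
      rw [hx]
    have e2 : ∫ x, ((memLp_deriv_heatKernel s).toLp _ : ℝ → ℝ) x * φ x
        = ∫ x, deriv (heatKernel s) x * φ x := by
      refine integral_congr_ae ?_
      filter_upwards [(memLp_deriv_heatKernel s).coeFn_toLp] with x hx
      rw [hx]
    refine e1.trans (Eq.trans ?_ (congrArg Neg.neg e2.symm))
    refine integral_mul_deriv_eq_deriv_mul_of_integrable
      (fun x _ => (hasDerivAt_heatKernel s x).differentiableAt.hasDerivAt)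
      (fun x _ => (hφ.differentiable (by simp) x).hasDerivAt) ?_ ?_ ?_
    · exact (memLp_heatKernel s).integrable_mul (memLp_deriv_of_test hφ hφc)
    · exact (memLp_deriv_heatKernel s).integrable_mul (memLp_of_test hφ hφc)
    · exact (memLp_heatKernel s).integrable_mul (memLp_of_test hφ hφc)⟩

/-- The heat semigroup `e^{sΔ} f` for `s > 0`: convolution of `f` with the heat kernel. -/
noncomputable def heatFlow (s : ℝ) (f : ℝ → ℝ) (x : ℝ) : ℝ :=
  ∫ y, heatKernel s (x - y) * f y

/-- The intensity `Ψ_t[v] = Φ(t) - a (v(-R) + v(R))` of the point source at the origin. -/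
noncomputable def feedback (R a : ℝ) (Φ : ℝ → ℝ) (t : ℝ) (v : H1) : ℝ :=
  Φ t - a * (v.rep (-R) + v.rep R)

/-- `u` is a mild solution in `H¹(ℝ)` of
`∂ₜ u = D ∂ₓ² u + (Φ(t) - a [u(t,-R) + u(t,R)]) δ₀`, `u(0) = u₀`:
a continuous curve `[0, ∞) → H¹(ℝ)` starting at `u₀` that satisfies the variation of constants
formula `u(t) = e^{tDΔ} u₀ + ∫₀ᵗ Ψ_τ[u(τ)] e^{(t-τ)DΔ} δ₀ dτ` for all `t > 0`, where the integral
is a Bochner integral in `H¹(ℝ)`.  (Values of `u` at negative times play no role.) -/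
structure IsMildSolution (D R a : ℝ) (Φ : ℝ → ℝ) (u₀ : H1) (u : ℝ → H1) : Prop where
  continuousOn : ContinuousOn u (Ici 0)
  initial : u 0 = u₀
  integrable : ∀ t, 0 < t → IntervalIntegrable
    (fun τ => feedback R a Φ τ (u τ) • heatKernelH1 (D * (t - τ))) volume 0 t
  variation_of_constants : ∀ t, 0 < t →
    (u t).rep =ᵐ[volume] fun x => heatFlow (D * t) u₀.rep x +
      (∫ τ in (0 : ℝ)..t, feedback R a Φ τ (u τ) • heatKernelH1 (D * (t - τ))).rep x

/-- `Φ ∈ L^∞_loc([0, ∞))`: measurable and essentially bounded on every `[0, T]`. -/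
def IsLocallyBounded (Φ : ℝ → ℝ) : Prop :=
  ∀ T : ℝ, MemLp Φ ∞ (volume.restrict (Icc 0 T))

/-- `Φ` is of (at most) exponential order on `[0, ∞)`. -/
def IsExponentialOrder (Φ : ℝ → ℝ) : Prop :=
  ∃ M γ : ℝ, 0 ≤ M ∧ ∀ᵐ t ∂(volume.restrict (Ici (0 : ℝ))), |Φ t| ≤ M * Real.exp (γ * t)

/-
Let `Ψ` be the intensity of the source. Heat found beyond `R` must have crossed `R`, so on `x > R`
the solution dominates its through part `w(x)`: the heat emitted at the origin together with the
initial heat that has visited `R`. By the first passage identity for the heat kernel, `w` is the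
average of the solution's values at `R` over the density of the time spent going from `R` to
`R + x`. The source term in `w'` is also such an average, of `Ψ` and over distance `R + x`; since
`Ψ ≥ -a (u(·, -R) + u(·, R))`, it is controlled by `w(x + R)` and by the through part of the
reflected solution at `x + R`. The two through parts differ only in the initial datum, whose
asymmetry is confined to `(-R/2, R/2)`, and this bounds the reflected one by `w(x + R)` plus the
flux `k ≥ 0` of initial heat accumulated over `[x, x + R]`. The outcome is the advanced
differential inequality
`w'(x) ≤ (a / D) (w(x + R) + ½ ∫_x^{x+R} k) - k(x)`.

As `a R / D ≤ e⁻¹`, there is `l ≤ 1 / R` with `l e^{-lR} = a / D`. For `g(x) = e^{-lx} w(x)` the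
inequality integrates to `g(x) ≥ l ∫_x^{x+R} g`; hence `w ≥ (1 - e^{-lR}) inf w`, which forces
`inf w ≥ 0`.
-/

theorem exists_delay_characteristic_root {c R : ℝ} (hR : 0 < R)
    (hc : c * R ∈ Ioc 0 (Real.exp (-1))) :
    ∃ l, 0 < l ∧ l * R ≤ 1 ∧ c = l * Real.exp (-(l * R)) := by
  have hcont : ContinuousOn (fun z : ℝ => z * Real.exp (-z)) (Icc 0 1) := by fun_prop
  obtain ⟨z, ⟨hz0, hz1⟩, hz⟩ : c * R ∈ (fun z : ℝ => z * Real.exp (-z)) '' Icc 0 1 :=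
    intermediate_value_Icc zero_le_one hcont (by simpa using Ioc_subset_Icc_self hc)
  have hz' : z * Real.exp (-z) = c * R := hz
  have hzpos : 0 < z := by
    rcases hz0.eq_or_lt with rfl | h
    · have := hc.1
      simp only [← hz', zero_mul, lt_self_iff_false] at this
    · exact h
  have hzR : z / R * R = z := div_mul_cancel₀ z hR.ne'
  refine ⟨z / R, div_pos hzpos hR, hzR.trans_le hz1, ?_⟩
  rw [hzR, div_mul_eq_mul_div, hz', mul_div_cancel_right₀ c hR.ne']

theorem nonneg_of_hasDerivAt_nonpos_of_tendsto_zero {f f' : ℝ → ℝ} {a x : ℝ}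
    (hf : ∀ y ∈ Ioi a, HasDerivAt f (f' y) y) (hf' : ∀ y ∈ Ioi a, f' y ≤ 0)
    (hlim : Tendsto f atTop (𝓝 0)) (hx : a < x) : 0 ≤ f x := by
  have hanti : AntitoneOn f (Ioi a) :=
    antitoneOn_of_hasDerivWithinAt_nonpos (convex_Ioi a) (f' := f')
      (fun y hy => (hf y hy).continuousAt.continuousWithinAt)
      (fun y hy => (hf y (interior_subset hy)).hasDerivWithinAt)
      (fun y hy => hf' y (interior_subset hy))
  exact le_of_tendsto hlim ((eventually_ge_atTop x).mono fun y hy => hanti hx (hx.trans_le hy) hy)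

section Windows

variable {p : ℝ → ℝ} {a R x : ℝ}

theorem intervalIntegrable_of_continuousOn_Ioi (hp : ContinuousOn p (Ioi a)) {b c : ℝ} (hb : a < b)
    (hc : a < c) : IntervalIntegrable p volume b c :=
  (hp.mono fun _ hy => (lt_min hb hc).trans_le hy.1).intervalIntegrable

theorem hasDerivAt_integral_window (hp : ContinuousOn p (Ioi a)) (hR : 0 ≤ R) (hx : a < x) :
    HasDerivAt (fun x => ∫ y in x..x + R, p y) (p (x + R) - p x) x := by
  have hxR : a < x + R := by linarith
  have hat : ∀ y, a < y → ContinuousAt p y := fun y hy => hp.continuousAt (Ioi_mem_nhds hy)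
  have hmeas : ∀ y, a < y → StronglyMeasurableAtFilter p (𝓝 y) volume := fun y hy =>
    hp.stronglyMeasurableAtFilter isOpen_Ioi y hy
  have hd := intervalIntegral.integral_hasFDerivAt
    (intervalIntegrable_of_continuousOn_Ioi hp hx hxR) (hmeas _ hx) (hmeas _ hxR)
    (hat _ hx) (hat _ hxR)
  have hg : HasDerivAt (fun x : ℝ => (x, x + R)) (1, 1) x :=
    (hasDerivAt_id x).prodMk ((hasDerivAt_id x).add_const R)
  simpa [Function.comp_def] using hd.comp_hasDerivAt x hg

theorem tendsto_integral_window (hR : 0 ≤ R) (hlim : Tendsto p atTop (𝓝 0)) :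
    Tendsto (fun x => ∫ y in x..x + R, p y) atTop (𝓝 0) := by
  rw [Metric.tendsto_atTop]
  intro ε hε
  obtain ⟨A, hA⟩ := Metric.tendsto_atTop.1 hlim (ε / (R + 1)) (by positivity)
  refine ⟨A, fun x hx => ?_⟩
  rw [dist_zero_right]
  calc ‖∫ y in x..x + R, p y‖ ≤ ε / (R + 1) * |x + R - x| := by
        refine intervalIntegral.norm_integral_le_of_norm_le_const fun y hy => ?_
        rw [uIoc_of_le (by linarith)] at hy
        exact (dist_zero_right (p y) ▸ hA y (hx.trans hy.1.le)).le
    _ = ε * (R / (R + 1)) := by rw [add_sub_cancel_left, abs_of_nonneg hR]; ring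
    _ < ε := mul_lt_of_lt_one_right hε ((div_lt_one (by linarith)).2 (by linarith))

theorem hasDerivAt_integral_Ioi (hp : IntegrableOn p (Ioi a)) (hpc : ContinuousOn p (Ioi a))
    (hx : a < x) : HasDerivAt (fun x => ∫ y in Ioi x, p y) (-p x) x := by
  have hd := intervalIntegral.integral_hasDerivAt_right (a := x) (b := x) (by simp)
    (hpc.stronglyMeasurableAtFilter isOpen_Ioi x hx) (hpc.continuousAt (Ioi_mem_nhds hx))
  refine (hd.const_sub (∫ y in Ioi x, p y)).congr_of_eventuallyEq ?_
  filter_upwards [Ioi_mem_nhds hx] with y hy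
  rw [← intervalIntegral.integral_Ioi_sub_Ioi' (hp.mono_set (Ioi_subset_Ioi hx.le))
    (hp.mono_set (Ioi_subset_Ioi (le_of_lt hy))), sub_sub_cancel]

theorem tendsto_integral_Ioi_zero (hp : IntegrableOn p (Ioi a)) :
    Tendsto (fun x => ∫ y in Ioi x, p y) atTop (𝓝 0) := by
  have h := (intervalIntegral_tendsto_integral_Ioi a hp tendsto_id).const_sub (∫ y in Ioi a, p y)
  rw [sub_self] at h
  refine h.congr' ?_
  filter_upwards [eventually_ge_atTop a] with x hx
  rw [id, ← intervalIntegral.integral_Ioi_sub_Ioi' hp (hp.mono_set (Ioi_subset_Ioi hx)),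
    sub_sub_cancel]

end Windows

theorem integral_exp_neg_mul_window {l : ℝ} (hl : l ≠ 0) (x R : ℝ) :
    l * ∫ y in x..x + R, Real.exp (-l * y) = Real.exp (-l * x) * (1 - Real.exp (-(l * R))) := by
  rw [intervalIntegral.integral_comp_mul_left (fun y => Real.exp y) (neg_ne_zero.2 hl),
    integral_exp, smul_eq_mul, mul_add, Real.exp_add, neg_mul l R]
  field_simp
  ring

theorem nonneg_of_forward_average_le {f : ℝ → ℝ} {a l R x : ℝ} (hl : 0 < l) (hR : 0 ≤ R)
    (hf : ContinuousOn f (Ioi a)) (hbdd : BddBelow (f '' Ioi a))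
    (havg : ∀ x ∈ Ioi a,
      l * ∫ y in x..x + R, Real.exp (-l * y) * f y ≤ Real.exp (-l * x) * f x)
    (hx : a < x) : 0 ≤ f x := by
  set i := sInf (f '' Ioi a)
  have hle : ∀ y ∈ Ioi a, i ≤ f y := fun y hy => csInf_le hbdd (mem_image_of_mem f hy)
  have hstep : ∀ x ∈ Ioi a, (1 - Real.exp (-(l * R))) * i ≤ f x := by
    intro x hx
    have hint : IntervalIntegrable (fun y => Real.exp (-l * y) * f y) volume x (x + R) :=
      intervalIntegrable_of_continuousOn_Ioi (by fun_prop) hx (hx.trans_le (by linarith))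
    refine le_of_mul_le_mul_left ?_ (Real.exp_pos (-l * x))
    calc Real.exp (-l * x) * ((1 - Real.exp (-(l * R))) * i)
        = l * ∫ y in x..x + R, Real.exp (-l * y) * i := by
          rw [intervalIntegral.integral_mul_const, ← mul_assoc, ← mul_assoc,
            integral_exp_neg_mul_window hl.ne']
      _ ≤ l * ∫ y in x..x + R, Real.exp (-l * y) * f y := by
          gcongr
          refine intervalIntegral.integral_mono_on (by linarith)
            (Continuous.intervalIntegrable (by fun_prop) _ _) hint fun y hy => ?_
          exact mul_le_mul_of_nonneg_left (hle y (hx.trans_le hy.1)) (Real.exp_pos _).le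
      _ ≤ Real.exp (-l * x) * f x := havg x hx
  have hi_le : (1 - Real.exp (-(l * R))) * i ≤ i :=
    le_csInf (nonempty_Ioi.image f) (forall_mem_image.2 hstep)
  have hi_nonneg : 0 ≤ i := by nlinarith [Real.exp_pos (-(l * R))]
  exact hi_nonneg.trans (hle x hx)

theorem integral_window_integral_Ioi_le {p : ℝ → ℝ} {a R x : ℝ} (hp : IntegrableOn p (Ioi a))
    (hpc : ContinuousOn p (Ioi a)) (hp0 : ∀ y ∈ Ioi a, 0 ≤ p y) (hR : 0 ≤ R) (hx : a < x) :
    ∫ y in x..x + R, ∫ z in Ioi y, p z ≤ R * ∫ z in Ioi x, p z := by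
  have htail : ContinuousOn (fun y => ∫ z in Ioi y, p z) (Ioi a) := fun y hy =>
    (hasDerivAt_integral_Ioi hp hpc hy).continuousAt.continuousWithinAt
  calc ∫ y in x..x + R, ∫ z in Ioi y, p z ≤ ∫ _ in x..x + R, ∫ z in Ioi x, p z := by
        refine intervalIntegral.integral_mono_on (by linarith)
          (intervalIntegrable_of_continuousOn_Ioi htail hx (by linarith)) (by simp) fun y hy => ?_
        exact setIntegral_mono_set (hp.mono_set (Ioi_subset_Ioi hx.le))
          ((ae_restrict_iff' measurableSet_Ioi).2 (.of_forall fun z hz => hp0 z (hx.trans hz)))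
          (Ioi_subset_Ioi hy.1).eventuallyLE
    _ = R * ∫ z in Ioi x, p z := by simp

theorem integral_window_le_of_deriv_le {f f' p : ℝ → ℝ} {a l R x : ℝ} (hl : 0 ≤ l)
    (hR : 0 ≤ R) (hlR : l * R ≤ 2) (hf : ∀ x ∈ Ioi a, HasDerivAt f (f' x) x)
    (hflim : Tendsto f atTop (𝓝 0)) (hp : IntegrableOn p (Ioi a)) (hpc : ContinuousOn p (Ioi a))
    (hp0 : ∀ x ∈ Ioi a, 0 ≤ p x)
    (hf' : ∀ x ∈ Ioi a, f' x ≤ l * (f (x + R) - f x) + l / 2 * (∫ y in x..x + R, p y) - p x)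
    (hx : a < x) : l * ∫ y in x..x + R, f y ≤ f x := by
  set P : ℝ → ℝ := fun y => ∫ z in Ioi y, p z
  have hfc : ContinuousOn f (Ioi a) := fun y hy => (hf y hy).continuousAt.continuousWithinAt
  have hP : ∀ y ∈ Ioi a, HasDerivAt P (-p y) y := fun y hy => hasDerivAt_integral_Ioi hp hpc hy
  have hPc : ContinuousOn P (Ioi a) := fun y hy => (hP y hy).continuousAt.continuousWithinAt
  have hPlim : Tendsto P atTop (𝓝 0) := tendsto_integral_Ioi_zero hp
  have hPsub : ∀ y ∈ Ioi a, P y - P (y + R) = ∫ z in y..y + R, p z := fun y hy =>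
    intervalIntegral.integral_Ioi_sub_Ioi (hp.mono_set (Ioi_subset_Ioi (le_of_lt hy)))
      (le_add_of_nonneg_right hR)
  have hdefect : 0 ≤ f x - l * (∫ y in x..x + R, f y) - P x + l / 2 * ∫ y in x..x + R, P y := by
    refine nonneg_of_hasDerivAt_nonpos_of_tendsto_zero
      (f := fun x => f x - l * (∫ y in x..x + R, f y) - P x + l / 2 * ∫ y in x..x + R, P y)
      (fun y hy => (((hf y hy).sub ((hasDerivAt_integral_window hfc hR hy).const_mul l)).sub
        (hP y hy)).add ((hasDerivAt_integral_window hPc hR hy).const_mul (l / 2)))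
      (fun y hy => ?_) ?_ hx
    · linear_combination hf' y hy - l / 2 * hPsub y hy
    · simpa using ((hflim.sub ((tendsto_integral_window hR hflim).const_mul l)).sub
        hPlim).add ((tendsto_integral_window hR hPlim).const_mul (l / 2))
  have hwindow : l / 2 * ∫ y in x..x + R, P y ≤ P x := by
    have hPx : 0 ≤ P x := setIntegral_nonneg measurableSet_Ioi fun y hy => hp0 y (hx.trans hy)
    calc l / 2 * ∫ y in x..x + R, P y ≤ l / 2 * (R * P x) := by
          gcongr; exact integral_window_integral_Ioi_le hp hpc hp0 hR hx
      _ ≤ P x := by nlinarith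
  linarith

theorem exp_neg_mul_integral_window_le {k : ℝ → ℝ} {a l R x : ℝ} (hl : 0 ≤ l) (hR : 0 ≤ R)
    (hk : ContinuousOn k (Ioi a)) (hk0 : ∀ y ∈ Ioi a, 0 ≤ k y) (hx : a < x) :
    Real.exp (-l * (x + R)) * ∫ y in x..x + R, k y ≤ ∫ y in x..x + R, Real.exp (-l * y) * k y := by
  have hxR : a < x + R := hx.trans_le (le_add_of_nonneg_right hR)
  rw [← intervalIntegral.integral_const_mul]
  refine intervalIntegral.integral_mono_on (le_add_of_nonneg_right hR)
    (intervalIntegrable_of_continuousOn_Ioi (by fun_prop) hx hxR)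
    (intervalIntegrable_of_continuousOn_Ioi (by fun_prop) hx hxR) fun y hy => ?_
  exact mul_le_mul_of_nonneg_right (Real.exp_le_exp.2 (by nlinarith [hy.2]))
    (hk0 y (hx.trans_le hy.1))

theorem nonneg_of_advanced_deriv_le {f f' k : ℝ → ℝ} {a l R C x : ℝ} (hl : 0 < l)
    (hR : 0 ≤ R) (hlR : l * R ≤ 2) (hf : ∀ x ∈ Ioi a, HasDerivAt f (f' x) x)
    (hfC : ∀ x ∈ Ioi a, |f x| ≤ C) (hk : ContinuousOn k (Ioi a)) (hk0 : ∀ x ∈ Ioi a, 0 ≤ k x)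
    (hkC : ∀ x ∈ Ioi a, k x ≤ C)
    (hf' : ∀ x ∈ Ioi a,
      f' x ≤ l * Real.exp (-(l * R)) * (f (x + R) + (∫ y in x..x + R, k y) / 2) - k x)
    (hx : a < x) : 0 ≤ f x := by
  have hfc : ContinuousOn f (Ioi a) := fun y hy => (hf y hy).continuousAt.continuousWithinAt
  have hE (y : ℝ) : HasDerivAt (fun y => Real.exp (-l * y)) (Real.exp (-l * y) * -l) y := by
    simpa only [id, mul_one] using ((hasDerivAt_id y).const_mul (-l)).exp
  have hflim : Tendsto (fun y => Real.exp (-l * y) * f y) atTop (𝓝 0) :=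
    Tendsto.zero_mul_isBoundedUnder_le
      (Real.tendsto_exp_atBot.comp (tendsto_id.const_mul_atTop_of_neg (neg_lt_zero.2 hl)))
      ⟨C, eventually_map.2 ((eventually_gt_atTop a).mono hfC)⟩
  have hkint : IntegrableOn (fun y => Real.exp (-l * y) * k y) (Ioi a) :=
    (exp_neg_integrableOn_Ioi a hl).mul_bdd (hk.aestronglyMeasurable measurableSet_Ioi)
      ((ae_restrict_iff' measurableSet_Ioi).2
        (.of_forall fun y hy => (abs_of_nonneg (hk0 y hy)).trans_le (hkC y hy)))
  have hbdd : BddBelow (f '' Ioi a) :=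
    ⟨-C, forall_mem_image.2 fun y hy => (abs_le.1 (hfC y hy)).1⟩
  refine nonneg_of_forward_average_le hl hR hfc hbdd (fun y hy => ?_) hx
  refine integral_window_le_of_deriv_le hl.le hR hlR (fun y hy => (hE y).mul (hf y hy)) hflim
    hkint (by fun_prop) (fun y hy => mul_nonneg (Real.exp_pos _).le (hk0 y hy)) (fun y hy => ?_) hy
  have hadd : Real.exp (-l * (y + R)) = Real.exp (-l * y) * Real.exp (-(l * R)) := by
    rw [← Real.exp_add]; ring_nf
  calc Real.exp (-l * y) * -l * f y + Real.exp (-l * y) * f' y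
      ≤ Real.exp (-l * y) * -l * f y + Real.exp (-l * y) *
        (l * Real.exp (-(l * R)) * (f (y + R) + (∫ z in y..y + R, k z) / 2) - k y) := by
        gcongr; exact hf' y hy
    _ = l * (Real.exp (-l * (y + R)) * f (y + R) - Real.exp (-l * y) * f y) +
        l / 2 * (Real.exp (-l * (y + R)) * ∫ z in y..y + R, k z) - Real.exp (-l * y) * k y := by
        rw [hadd]; ring
    _ ≤ _ := by gcongr; exact exp_neg_mul_integral_window_le hl.le hR hk hk0 hy

/-- The negative spatial derivative of the heat kernel. -/
noncomputable def heatFlux (s x : ℝ) : ℝ := x / (2 * s) * heatKernel s x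

theorem heatKernel_nonneg (s x : ℝ) : 0 ≤ heatKernel s x := by
  unfold heatKernel; positivity

theorem heatKernel_neg (s x : ℝ) : heatKernel s (-x) = heatKernel s x := by
  simp [heatKernel]

theorem heatKernel_abs (s x : ℝ) : heatKernel s |x| = heatKernel s x := by
  simp [heatKernel]

theorem heatKernel_le_of_le {s x y : ℝ} (hx : 0 ≤ x) (hxy : x ≤ y) :
    heatKernel s y ≤ heatKernel s x := by
  rcases le_or_gt s 0 with hs | hs
  · simp [heatKernel_of_nonpos hs]
  · unfold heatKernel
    gcongr

theorem heatFlux_neg (s x : ℝ) : heatFlux s (-x) = -heatFlux s x := by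
  rw [heatFlux, heatKernel_neg, heatFlux, neg_div, neg_mul]

theorem heatFlux_of_nonpos {s : ℝ} (hs : s ≤ 0) (x : ℝ) : heatFlux s x = 0 := by
  simp [heatFlux, heatKernel_of_nonpos hs]

theorem heatFlux_nonneg {s x : ℝ} (hx : 0 ≤ x) : 0 ≤ heatFlux s x := by
  rcases le_or_gt s 0 with hs | hs
  · simp [heatFlux_of_nonpos hs]
  · exact mul_nonneg (by positivity) (heatKernel_nonneg s x)

theorem hasDerivAt_heatKernel_heatFlux (s x : ℝ) :
    HasDerivAt (heatKernel s) (-heatFlux s x) x := by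
  refine (hasDerivAt_heatKernel s x).congr_deriv ?_
  rcases eq_or_ne s 0 with rfl | h
  · simp [heatFlux]
  · rw [heatFlux]; field_simp; ring

theorem continuous_heatKernel (s : ℝ) : Continuous (heatKernel s) :=
  continuous_iff_continuousAt.2 fun x => (hasDerivAt_heatKernel s x).continuousAt

theorem continuous_heatFlux (s : ℝ) : Continuous (heatFlux s) :=
  (continuous_id.div_const _).mul (continuous_heatKernel s)

theorem measurable_heatKernel : Measurable fun p : ℝ × ℝ => heatKernel p.1 p.2 := by
  unfold heatKernel; fun_prop

theorem measurable_heatFlux : Measurable fun p : ℝ × ℝ => heatFlux p.1 p.2 :=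
  (measurable_snd.div (measurable_fst.const_mul 2)).mul measurable_heatKernel

theorem heatKernel_le_exp_div_sqrt (s x : ℝ) :
    heatKernel s x ≤ Real.exp (-x ^ 2 / (4 * s)) / √s := by
  rcases le_or_gt s 0 with hs | hs
  · rw [heatKernel_of_nonpos hs]; positivity
  · unfold heatKernel
    gcongr
    nlinarith [Real.pi_gt_three]

theorem heatKernel_le {r s T x : ℝ} (hr : 0 < r) (hx : r ≤ x) (hs : s ≤ T) :
    heatKernel s x ≤ 4 * √T / r ^ 2 := by
  rcases le_or_gt s 0 with hs0 | hs0
  · rw [heatKernel_of_nonpos hs0]; positivity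
  have hexp : Real.exp (-r ^ 2 / (4 * s)) ≤ 4 * s / r ^ 2 := by
    rw [neg_div, Real.exp_neg, ← inv_div (r ^ 2)]
    exact inv_anti₀ (by positivity)
      ((le_add_of_nonneg_right zero_le_one).trans (Real.add_one_le_exp _))
  calc heatKernel s x ≤ heatKernel s r := heatKernel_le_of_le hr.le hx
    _ ≤ (4 * s / r ^ 2) / √s := (heatKernel_le_exp_div_sqrt s r).trans (by gcongr)
    _ = 4 * √s / r ^ 2 := by rw [div_right_comm, mul_div_assoc, Real.div_sqrt]
    _ ≤ 4 * √T / r ^ 2 := by gcongr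

theorem heatFlux_le {r s T x : ℝ} (hr : 0 < r) (hx : r ≤ x) (hs : s ≤ T) :
    heatFlux s x ≤ 16 * √T / r ^ 3 := by
  have hx0 : 0 < x := hr.trans_le hx
  rcases le_or_gt s 0 with hs0 | hs0
  · rw [heatFlux_of_nonpos hs0]; positivity
  have hexp : Real.exp (-x ^ 2 / (4 * s)) ≤ 32 * s ^ 2 / x ^ 4 := by
    have hv : 0 < x ^ 2 / (4 * s) := by positivity
    rw [neg_div, Real.exp_neg,
      show 32 * s ^ 2 / x ^ 4 = ((x ^ 2 / (4 * s)) ^ 2 / 2)⁻¹ by field_simp; norm_num]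
    refine inv_anti₀ (by positivity) ?_
    linarith [Real.quadratic_le_exp_of_nonneg hv.le]
  calc heatFlux s x ≤ x / (2 * s) * ((32 * s ^ 2 / x ^ 4) / √s) := by
        unfold heatFlux
        gcongr
        exact (heatKernel_le_exp_div_sqrt s x).trans (by gcongr)
    _ = 16 * (s / √s) / x ^ 3 := by field_simp; norm_num
    _ = 16 * √s / x ^ 3 := by rw [Real.div_sqrt]
    _ ≤ 16 * √T / r ^ 3 := by gcongr

theorem heatKernel_eq_gaussian (s x : ℝ) :
    heatKernel s x = Real.exp (-(1 / (4 * s)) * x ^ 2) / √(4 * Real.pi * s) := by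
  rw [heatKernel, neg_mul, one_div_mul_eq_div, neg_div]

theorem integrable_heatKernel {s : ℝ} (hs : 0 < s) : Integrable (heatKernel s) := by
  simp only [funext (heatKernel_eq_gaussian s)]
  exact (integrable_exp_neg_mul_sq (by positivity)).div_const _

theorem integral_heatKernel_Ioi {s : ℝ} (hs : 0 < s) : ∫ x in Ioi 0, heatKernel s x = 1 / 2 := by
  simp only [heatKernel_eq_gaussian s]
  rw [integral_div, integral_gaussian_Ioi, div_div_eq_mul_div, div_one, ← mul_assoc,
    mul_comm Real.pi, div_right_comm, div_self (Real.sqrt_pos.2 (by positivity)).ne']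

theorem tendsto_integral_heatKernel_atTop {s : ℝ} (hs : 0 < s) :
    Tendsto (fun v => ∫ x in (0 : ℝ)..v, heatKernel s x) atTop (𝓝 (1 / 2)) := by
  rw [← integral_heatKernel_Ioi hs]
  exact intervalIntegral_tendsto_integral_Ioi 0 (integrable_heatKernel hs).integrableOn tendsto_id

theorem tendsto_integral_heatKernel_atBot {s : ℝ} (hs : 0 < s) :
    Tendsto (fun v => ∫ x in (0 : ℝ)..v, heatKernel s x) atBot (𝓝 (-(1 / 2))) := by
  refine ((tendsto_integral_heatKernel_atTop hs).comp tendsto_neg_atBot_atTop).neg.congr fun v => ?_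
  have h := intervalIntegral.integral_comp_neg (a := 0) (b := v) (heatKernel s)
  simp only [heatKernel_neg, neg_zero] at h
  rw [Function.comp, h, intervalIntegral.integral_symm, neg_neg]

/-- The coordinate of a Brownian bridge from `-y` to `x` of duration `T` which is at the origin at
time `s`: the deviation of the origin from the chord, normalised by the standard deviation
`√(s (T - s))` of the bridge (up to a constant). It makes `heatKernel (T - s) x * heatKernel s y`
factor through `heatKernel T (x + y)`. -/
noncomputable def bridgeCoordinate (T x y s : ℝ) : ℝ :=
  (x * s - y * (T - s)) / √(s * (T - s))

theorem heatKernel_add_mul_heatKernel_bridgeCoordinate {T x y s : ℝ} (hs : s ∈ Ioo 0 T) :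
    T * (heatKernel T (x + y) * heatKernel T (bridgeCoordinate T x y s)) =
      √(s * (T - s)) * (heatKernel (T - s) x * heatKernel s y) := by
  have hs0 : 0 < s := hs.1
  have hs1 : 0 < T - s := sub_pos.2 hs.2
  have hT : 0 < T := hs0.trans hs.2
  have hexp : -(x + y) ^ 2 / (4 * T) + -bridgeCoordinate T x y s ^ 2 / (4 * T) =
      -x ^ 2 / (4 * (T - s)) + -y ^ 2 / (4 * s) := by
    rw [bridgeCoordinate, div_pow, Real.sq_sqrt (by positivity)]
    field_simp
    ring
  have hden : √(4 * Real.pi * (T - s)) * √(4 * Real.pi * s) = 4 * Real.pi * √(s * (T - s)) := by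
    rw [← Real.sqrt_mul (by positivity),
      show 4 * Real.pi * (T - s) * (4 * Real.pi * s) = (4 * Real.pi) ^ 2 * (s * (T - s)) by ring,
      Real.sqrt_mul (by positivity), Real.sqrt_sq (by positivity)]
  simp only [heatKernel]
  rw [div_mul_div_comm, div_mul_div_comm, ← Real.exp_add, ← Real.exp_add, hexp, hden,
    Real.mul_self_sqrt (by positivity)]
  field_simp

theorem hasDerivAt_bridgeCoordinate {T s : ℝ} (x y : ℝ) (hs : s ∈ Ioo 0 T) :
    HasDerivAt (bridgeCoordinate T x y)
      (T * (x / (2 * (T - s)) + y / (2 * s)) / √(s * (T - s))) s := by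
  have hs0 : 0 < s := hs.1
  have hs1 : 0 < T - s := sub_pos.2 hs.2
  have hpos : 0 < s * (T - s) := mul_pos hs0 hs1
  have hnum : HasDerivAt (fun s => x * s - y * (T - s)) (x * 1 - y * -1) s :=
    ((hasDerivAt_id s).const_mul x).sub (((hasDerivAt_id s).const_sub T).const_mul y)
  have hden := ((hasDerivAt_id s).mul ((hasDerivAt_id s).const_sub T)).sqrt hpos.ne'
  refine (hnum.div hden (Real.sqrt_pos.2 hpos).ne').congr_deriv ?_
  simp only [Pi.mul_apply, id]
  have hsq := Real.sq_sqrt hpos.le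
  have hne := (Real.sqrt_pos.2 hpos).ne'
  generalize √(s * (T - s)) = d at *
  field_simp
  rw [hsq]
  ring

theorem hasDerivAt_integral_bridgeCoordinate {T s : ℝ} (x y : ℝ) (hs : s ∈ Ioo 0 T) :
    HasDerivAt
      (fun s => heatKernel T (x + y) * ∫ v in (0 : ℝ)..bridgeCoordinate T x y s, heatKernel T v)
      (heatFlux (T - s) x * heatKernel s y + heatKernel (T - s) x * heatFlux s y) s := by
  have hs0 : 0 < s := hs.1
  have hs1 : 0 < T - s := sub_pos.2 hs.2
  have hd : √(s * (T - s)) ≠ 0 := (Real.sqrt_pos.2 (mul_pos hs0 hs1)).ne'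
  have hprim := ((continuous_heatKernel T).integral_hasStrictDerivAt 0
    (bridgeCoordinate T x y s)).hasDerivAt.comp s (hasDerivAt_bridgeCoordinate x y hs)
  refine (hprim.const_mul (heatKernel T (x + y))).congr_deriv ?_
  calc _ = T * (heatKernel T (x + y) * heatKernel T (bridgeCoordinate T x y s)) *
        (x / (2 * (T - s)) + y / (2 * s)) / √(s * (T - s)) := by ring
    _ = _ := by
      rw [heatKernel_add_mul_heatKernel_bridgeCoordinate hs, heatFlux, heatFlux]
      field_simp

theorem tendsto_inv_sqrt_mul_sub_left {T : ℝ} (hT : 0 < T) :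
    Tendsto (fun s => (√(s * (T - s)))⁻¹) (𝓝[>] 0) atTop := by
  refine tendsto_inv_nhdsGT_zero.comp (tendsto_nhdsWithin_iff.2 ⟨?_, ?_⟩)
  · exact tendsto_nhdsWithin_of_tendsto_nhds (Continuous.tendsto' (by fun_prop) _ _ (by simp))
  · filter_upwards [Ioo_mem_nhdsGT hT] with s hs
    exact Real.sqrt_pos.2 (mul_pos hs.1 (sub_pos.2 hs.2))

theorem tendsto_inv_sqrt_mul_sub_right {T : ℝ} (hT : 0 < T) :
    Tendsto (fun s => (√(s * (T - s)))⁻¹) (𝓝[<] T) atTop := by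
  refine tendsto_inv_nhdsGT_zero.comp (tendsto_nhdsWithin_iff.2 ⟨?_, ?_⟩)
  · exact tendsto_nhdsWithin_of_tendsto_nhds (Continuous.tendsto' (by fun_prop) _ _ (by simp))
  · filter_upwards [Ioo_mem_nhdsLT hT] with s hs
    exact Real.sqrt_pos.2 (mul_pos hs.1 (sub_pos.2 hs.2))

theorem tendsto_bridgeCoordinate_right {T x : ℝ} (y : ℝ) (hT : 0 < T) (hx : 0 < x) :
    Tendsto (bridgeCoordinate T x y) (𝓝[<] T) atTop :=
  (tendsto_nhdsWithin_of_tendsto_nhds (Continuous.tendsto' (by fun_prop) _ _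
    (by simp))).pos_mul_atTop (mul_pos hx hT) (tendsto_inv_sqrt_mul_sub_right hT)

theorem tendsto_bridgeCoordinate_left_atBot {T y : ℝ} (x : ℝ) (hT : 0 < T) (hy : 0 < y) :
    Tendsto (bridgeCoordinate T x y) (𝓝[>] 0) atBot :=
  (tendsto_nhdsWithin_of_tendsto_nhds (Continuous.tendsto' (by fun_prop) _ _
    (by simp))).neg_mul_atTop (neg_lt_zero.2 (mul_pos hy hT)) (tendsto_inv_sqrt_mul_sub_left hT)

theorem tendsto_bridgeCoordinate_left_atTop {T y : ℝ} (x : ℝ) (hT : 0 < T) (hy : y < 0) :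
    Tendsto (bridgeCoordinate T x y) (𝓝[>] 0) atTop :=
  (tendsto_nhdsWithin_of_tendsto_nhds (Continuous.tendsto' (by fun_prop) _ _
    (by simp))).pos_mul_atTop (neg_pos.2 (mul_neg_of_neg_of_pos hy hT))
    (tendsto_inv_sqrt_mul_sub_left hT)

theorem integrableOn_heatFlux_mul_heatKernel {T x y : ℝ} (hx : 0 < x) (hy : 0 < y) :
    IntegrableOn (fun s => heatFlux (T - s) x * heatKernel s y) (Ioc 0 T) := by
  have hm : Measurable fun s => heatFlux (T - s) x * heatKernel s y :=
    (measurable_heatFlux.comp (by fun_prop : Measurable fun s : ℝ => (T - s, x))).mul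
      (measurable_heatKernel.comp (by fun_prop : Measurable fun s : ℝ => (s, y)))
  refine IntegrableOn.of_bound measure_Ioc_lt_top hm.aestronglyMeasurable
    ((16 * √T / x ^ 3) * (4 * √T / y ^ 2))
    ((ae_restrict_iff' measurableSet_Ioc).2 (ae_of_all _ fun s hs => ?_))
  rw [Real.norm_of_nonneg (mul_nonneg (heatFlux_nonneg hx.le) (heatKernel_nonneg _ _))]
  exact mul_le_mul (heatFlux_le hx le_rfl (by linarith [hs.1])) (heatKernel_le hy le_rfl hs.2)
    (heatKernel_nonneg _ _) (by positivity)

theorem integral_heatFlux_mul_heatKernel {T x y : ℝ} (hT : 0 < T) (hx : 0 < x) (hy : 0 < y) :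
    ∫ s in (0 : ℝ)..T, 2 * (heatFlux (T - s) x * heatKernel s y) = heatKernel T (x + y) := by
  have hderiv : ∀ s ∈ Ioo 0 T, HasDerivAt
      (fun s => heatKernel T (x + y) * (∫ v in (0 : ℝ)..bridgeCoordinate T x y s, heatKernel T v) +
        heatKernel T (x + -y) * ∫ v in (0 : ℝ)..bridgeCoordinate T x (-y) s, heatKernel T v)
      (2 * (heatFlux (T - s) x * heatKernel s y)) s := fun s hs => by
    refine ((hasDerivAt_integral_bridgeCoordinate x y hs).add
      (hasDerivAt_integral_bridgeCoordinate x (-y) hs)).congr_deriv ?_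
    rw [heatKernel_neg, heatFlux_neg]
    ring
  have htop := tendsto_integral_heatKernel_atTop hT
  have hleft := (((tendsto_integral_heatKernel_atBot hT).comp
    (tendsto_bridgeCoordinate_left_atBot x hT hy)).const_mul (heatKernel T (x + y))).add
    ((htop.comp (tendsto_bridgeCoordinate_left_atTop x hT (neg_lt_zero.2 hy))).const_mul
      (heatKernel T (x + -y)))
  have hright := ((htop.comp (tendsto_bridgeCoordinate_right y hT hx)).const_mul
    (heatKernel T (x + y))).add
    ((htop.comp (tendsto_bridgeCoordinate_right (-y) hT hx)).const_mul (heatKernel T (x + -y)))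
  rw [intervalIntegral.integral_eq_sub_of_hasDerivAt_of_tendsto hT hderiv
    (((intervalIntegrable_iff_integrableOn_Ioc_of_le hT.le).2
      (integrableOn_heatFlux_mul_heatKernel hx hy)).const_mul 2) hleft hright]
  ring

theorem heatKernel_pos {s : ℝ} (hs : 0 < s) (x : ℝ) : 0 < heatKernel s x := by
  unfold heatKernel; positivity

/-- The density of the first time at which a Brownian motion of diffusivity `D` started at `x > 0`
reaches the origin. -/
noncomputable def firstPassageDensity (D t x : ℝ) : ℝ := 2 * D * heatFlux (D * t) x

theorem firstPassageDensity_nonneg {D x : ℝ} (hD : 0 ≤ D) (hx : 0 ≤ x) (t : ℝ) :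
    0 ≤ firstPassageDensity D t x :=
  mul_nonneg (by positivity) (heatFlux_nonneg hx)

theorem integral_firstPassageDensity_mul_heatKernel {D t x z : ℝ} (hD : 0 < D) (ht : 0 < t)
    (hx : 0 < x) (hz : z ≠ 0) :
    ∫ s in (0 : ℝ)..t, firstPassageDensity D (t - s) x * heatKernel (D * s) z =
      heatKernel (D * t) (x + |z|) := by
  have hscale := intervalIntegral.mul_integral_comp_mul_left (a := 0) (b := t)
    (f := fun s => 2 * (heatFlux (D * t - s) x * heatKernel s |z|)) D
  rw [mul_zero, integral_heatFlux_mul_heatKernel (mul_pos hD ht) hx (abs_pos.2 hz)] at hscale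
  rw [← hscale, ← intervalIntegral.integral_const_mul]
  simp only [firstPassageDensity, heatKernel_abs, mul_sub]
  exact intervalIntegral.integral_congr fun s _ => by ring

theorem setIntegral_firstPassageDensity_mul_heatKernel {D t τ x z : ℝ} (hD : 0 < D) (hx : 0 < x)
    (hτ : τ ∈ Ico 0 t) (hz : z ≠ 0) :
    ∫ s in Ioc 0 t, firstPassageDensity D (t - s) x * heatKernel (D * (s - τ)) z =
      heatKernel (D * (t - τ)) (x + |z|) := by
  have hvanish : ∀ s ∈ Ioc 0 t \ Ioc τ t,
      firstPassageDensity D (t - s) x * heatKernel (D * (s - τ)) z = 0 := fun s hs => by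
    have hsτ : s ≤ τ := not_lt.1 fun h => hs.2 ⟨h, hs.1.2⟩
    rw [heatKernel_of_nonpos (mul_nonpos_of_nonneg_of_nonpos hD.le (sub_nonpos.2 hsτ)), mul_zero]
  have hshift := intervalIntegral.integral_comp_sub_right (a := τ) (b := t)
    (fun s => firstPassageDensity D (t - τ - s) x * heatKernel (D * s) z) τ
  simp only [sub_self, sub_sub_sub_cancel_right] at hshift
  rw [setIntegral_eq_of_subset_of_forall_sdiff_eq_zero measurableSet_Ioc
    (Ioc_subset_Ioc_left hτ.1) hvanish, ← intervalIntegral.integral_of_le hτ.2.le, hshift,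
    integral_firstPassageDensity_mul_heatKernel hD (sub_pos.2 hτ.2) hx hz]

section Superposition

variable {α : Type*} [MeasurableSpace α] {μ : Measure α} {w s τ z b : α → ℝ} {D t x : ℝ}

theorem measurable_heatKernel_comp (hs : Measurable s) (hz : Measurable z) :
    Measurable fun p => heatKernel (s p) (z p) :=
  measurable_heatKernel.comp (hs.prodMk hz)

theorem measurable_heatFlux_comp (hs : Measurable s) (hz : Measurable z) :
    Measurable fun p => heatFlux (s p) (z p) :=
  measurable_heatFlux.comp (hs.prodMk hz)

theorem integrable_firstPassageDensity_mul_superposition [SFinite μ] (hD : 0 < D) (hx : 0 < x)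
    (hw : AEStronglyMeasurable w μ) (hτ : Measurable τ) (hz : Measurable z)
    (hτz : ∀ᵐ p ∂μ, τ p ∈ Ico 0 t ∧ z p ≠ 0)
    (hint : Integrable (fun p => w p * heatKernel (D * (t - τ p)) (x + |z p|)) μ) :
    Integrable (Function.uncurry fun s p =>
        firstPassageDensity D (t - s) x * (w p * heatKernel (D * (s - τ p)) (z p)))
      ((volume.restrict (Ioc 0 t)).prod μ) := by
  have hmeas : AEStronglyMeasurable (Function.uncurry fun s p =>
      firstPassageDensity D (t - s) x * (w p * heatKernel (D * (s - τ p)) (z p)))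
      ((volume.restrict (Ioc 0 t)).prod μ) :=
    AEStronglyMeasurable.mul
      ((measurable_heatFlux_comp (by fun_prop) (by fun_prop)).const_mul
        (2 * D)).aestronglyMeasurable
      (hw.comp_snd.mul
        (measurable_heatKernel_comp (by fun_prop) (by fun_prop)).aestronglyMeasurable)
  rw [integrable_prod_iff' hmeas]
  constructor
  · filter_upwards [hτz] with p ⟨hτp, hzp⟩
    have h : IntegrableOn (fun s => firstPassageDensity D (t - s) x *
        heatKernel (D * (s - τ p)) (z p)) (Ioc 0 t) := .of_integral_ne_zero <| by
      rw [setIntegral_firstPassageDensity_mul_heatKernel hD hx hτp hzp]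
      exact (heatKernel_pos (mul_pos hD (sub_pos.2 hτp.2)) _).ne'
    simpa only [Function.uncurry, mul_left_comm] using h.const_mul (w p)
  · refine hint.norm.congr ?_
    filter_upwards [hτz] with p ⟨hτp, hzp⟩
    simp only [Function.uncurry, norm_mul, Real.norm_of_nonneg (heatKernel_nonneg _ _),
      Real.norm_of_nonneg (firstPassageDensity_nonneg hD.le hx.le _), mul_left_comm _ ‖w p‖]
    rw [integral_const_mul, setIntegral_firstPassageDensity_mul_heatKernel hD hx hτp hzp]

theorem integrableOn_firstPassageDensity_mul_integral [SFinite μ] (hD : 0 < D) (hx : 0 < x)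
    (hw : AEStronglyMeasurable w μ) (hτ : Measurable τ) (hz : Measurable z)
    (hτz : ∀ᵐ p ∂μ, τ p ∈ Ico 0 t ∧ z p ≠ 0)
    (hint : Integrable (fun p => w p * heatKernel (D * (t - τ p)) (x + |z p|)) μ) :
    IntegrableOn (fun s => firstPassageDensity D (t - s) x *
      ∫ p, w p * heatKernel (D * (s - τ p)) (z p) ∂μ) (Ioc 0 t) := by
  have h := (integrable_firstPassageDensity_mul_superposition hD hx hw hτ hz hτz
    hint).integral_prod_left
  simpa only [IntegrableOn, Function.uncurry, integral_const_mul] using h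

theorem setIntegral_firstPassageDensity_mul_integral [SFinite μ] (hD : 0 < D) (hx : 0 < x)
    (hw : AEStronglyMeasurable w μ) (hτ : Measurable τ) (hz : Measurable z)
    (hτz : ∀ᵐ p ∂μ, τ p ∈ Ico 0 t ∧ z p ≠ 0)
    (hint : Integrable (fun p => w p * heatKernel (D * (t - τ p)) (x + |z p|)) μ) :
    ∫ s in Ioc 0 t, firstPassageDensity D (t - s) x *
        ∫ p, w p * heatKernel (D * (s - τ p)) (z p) ∂μ =
      ∫ p, w p * heatKernel (D * (t - τ p)) (x + |z p|) ∂μ := by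
  simp only [← integral_const_mul]
  rw [integral_integral_swap
    (integrable_firstPassageDensity_mul_superposition hD hx hw hτ hz hτz hint)]
  refine integral_congr_ae ?_
  filter_upwards [hτz] with p ⟨hτp, hzp⟩
  simp only [mul_left_comm _ (w p)]
  rw [integral_const_mul, setIntegral_firstPassageDensity_mul_heatKernel hD hx hτp hzp]

theorem hasDerivAt_integral_mul_heatKernel {r : ℝ}
    (hw : AEStronglyMeasurable w μ) (hs : Measurable s) (hz : Measurable z) (hr : r < x)
    (hint : Integrable (fun p => w p * heatKernel (s p) (x + z p)) μ)
    (hb : ∀ᵐ p ∂μ, ∀ x ∈ Ioi r, |w p * heatFlux (s p) (x + z p)| ≤ b p) (hbi : Integrable b μ) :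
    HasDerivAt (fun x => ∫ p, w p * heatKernel (s p) (x + z p) ∂μ)
      (-∫ p, w p * heatFlux (s p) (x + z p) ∂μ) x := by
  have h := hasDerivAt_integral_of_dominated_loc_of_deriv_le (μ := μ) (𝕜 := ℝ) (bound := b)
    (F := fun x p => w p * heatKernel (s p) (x + z p))
    (F' := fun x p => w p * -heatFlux (s p) (x + z p)) (Ioi_mem_nhds hr)
    (.of_forall fun x => hw.mul
      (measurable_heatKernel_comp hs (hz.const_add x)).aestronglyMeasurable)
    hint (hw.mul (measurable_heatFlux_comp hs (hz.const_add x)).neg.aestronglyMeasurable)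
    (by simpa only [mul_neg, norm_neg, Real.norm_eq_abs] using hb) hbi
    (.of_forall fun p x _ =>
      ((hasDerivAt_heatKernel_heatFlux (s p) (x + z p)).comp_add_const x (z p)).const_mul (w p))
  simpa only [mul_neg, integral_neg] using h.2

end Superposition

theorem heatFlux_le_heatKernel_two_mul {s : ℝ} (hs : 0 < s) (z : ℝ) :
    heatFlux s z ≤ heatKernel (2 * s) z / √s := by
  have hz : z ≤ √(2 * s) * Real.exp (z ^ 2 / (8 * s)) := by
    have hsq : √(2 * s) ^ 2 = 2 * s := Real.sq_sqrt (by positivity)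
    have hpos : 0 < √(2 * s) := Real.sqrt_pos.2 (by positivity)
    calc z ≤ √(2 * s) * (z ^ 2 / (8 * s) + 1) := by
          rw [show 8 * s = 4 * √(2 * s) ^ 2 by rw [hsq]; ring]
          field_simp
          nlinarith [sq_nonneg (z - 2 * √(2 * s))]
      _ ≤ √(2 * s) * Real.exp (z ^ 2 / (8 * s)) := by gcongr; exact Real.add_one_le_exp _
  have hexp : Real.exp (z ^ 2 / (8 * s)) * Real.exp (-z ^ 2 / (4 * s)) =
      Real.exp (-z ^ 2 / (4 * (2 * s))) := by
    rw [← Real.exp_add]; congr 1; field_simp; ring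
  have hroot : √(2 * s) / (2 * s) / √(4 * Real.pi * s) = 1 / √(4 * Real.pi * (2 * s)) / √s := by
    have h₂ : (√2 : ℝ) ^ 2 = 2 := Real.sq_sqrt zero_le_two
    have hs' : √s ^ 2 = s := Real.sq_sqrt hs.le
    rw [mul_left_comm _ 2 s, Real.sqrt_mul zero_le_two, Real.sqrt_mul zero_le_two]
    field_simp
    rw [h₂, hs']
  calc heatFlux s z = z * Real.exp (-z ^ 2 / (4 * s)) / (2 * s) / √(4 * Real.pi * s) := by
        rw [heatFlux, heatKernel]; ring
    _ ≤ √(2 * s) * Real.exp (z ^ 2 / (8 * s)) * Real.exp (-z ^ 2 / (4 * s)) / (2 * s) /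
        √(4 * Real.pi * s) := by gcongr
    _ = Real.exp (-z ^ 2 / (4 * (2 * s))) * (√(2 * s) / (2 * s) / √(4 * Real.pi * s)) := by
        rw [mul_assoc, hexp]; ring
    _ = heatKernel (2 * s) z / √s := by rw [hroot, heatKernel]; ring

theorem integrable_mul_heatKernel_sub (s x : ℝ) {f : ℝ → ℝ} (hf : MemLp f 2) :
    Integrable fun y => f y * heatKernel s (x - y) :=
  hf.integrable_mul
    ((memLp_heatKernel s).comp_measurePreserving (Measure.measurePreserving_sub_left volume x))

/-- The part of the heat flow of `f` at distance `x` from `R` which has visited the point `R`,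
both sides of `R` being treated alike. -/
noncomputable def hittingFlow (T R : ℝ) (f : ℝ → ℝ) (x : ℝ) : ℝ :=
  ∫ y, f y * heatKernel T (x + |R - y|)

/-- The negative spatial derivative of `hittingFlow`. -/
noncomputable def hittingFlux (T R : ℝ) (f : ℝ → ℝ) (x : ℝ) : ℝ :=
  ∫ y, f y * heatFlux T (x + |R - y|)

section HittingFlow

variable {T R x : ℝ} {f : ℝ → ℝ}

theorem heatKernel_add_abs_le (hx : 0 ≤ x) (s z : ℝ) :
    heatKernel s (x + |z|) ≤ heatKernel s z := by
  rw [← heatKernel_abs s z]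
  exact heatKernel_le_of_le (abs_nonneg z) (le_add_of_nonneg_left hx)

theorem integrable_mul_heatKernel_add_abs_sub (T R : ℝ) (hf : MemLp f 2) (hx : 0 ≤ x) :
    Integrable fun y => f y * heatKernel T (x + |R - y|) := by
  refine (integrable_mul_heatKernel_sub T R hf).mono
    (hf.aestronglyMeasurable.mul
      (measurable_heatKernel_comp (by fun_prop) (by fun_prop)).aestronglyMeasurable)
    (.of_forall fun y => ?_)
  simp only [norm_mul, Real.norm_of_nonneg (heatKernel_nonneg _ _)]
  gcongr
  exact heatKernel_add_abs_le hx T (R - y)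

theorem hittingFlow_nonneg (hf0 : ∀ y, 0 ≤ f y) (x : ℝ) : 0 ≤ hittingFlow T R f x :=
  integral_nonneg fun y => mul_nonneg (hf0 y) (heatKernel_nonneg _ _)

theorem hittingFlux_nonneg (hf0 : ∀ y, 0 ≤ f y) (hx : 0 ≤ x) : 0 ≤ hittingFlux T R f x :=
  integral_nonneg fun y => mul_nonneg (hf0 y) (heatFlux_nonneg (by positivity))

theorem hittingFlow_le_heatFlow (hf : MemLp f 2) (hf0 : ∀ y, 0 ≤ f y) (hx : 0 ≤ x) :
    hittingFlow T R f x ≤ heatFlow T f (x + R) := by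
  simp only [hittingFlow, heatFlow, mul_comm (heatKernel T _)]
  refine integral_mono (integrable_mul_heatKernel_add_abs_sub T R hf hx)
    (integrable_mul_heatKernel_sub T (x + R) hf) fun y => ?_
  refine mul_le_mul_of_nonneg_left ?_ (hf0 y)
  rw [← heatKernel_abs T (x + R - y)]
  refine heatKernel_le_of_le (abs_nonneg _) ?_
  rw [add_sub_assoc]
  exact (abs_add_le x (R - y)).trans_eq (by rw [abs_of_nonneg hx])

theorem hittingFlow_le (hf : MemLp f 2) (hf0 : ∀ y, 0 ≤ f y) (hx : 0 ≤ x) :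
    hittingFlow T R f x ≤ ∫ y, f y * heatKernel T (R - y) :=
  integral_mono (integrable_mul_heatKernel_add_abs_sub T R hf hx)
    (integrable_mul_heatKernel_sub T R hf)
    fun y => mul_le_mul_of_nonneg_left (heatKernel_add_abs_le hx T _) (hf0 y)

theorem abs_mul_heatFlux_add_abs_le (hT : 0 < T) (hx : 0 ≤ x) (c z : ℝ) :
    |c * heatFlux T (x + |z|)| ≤ |c * heatKernel (2 * T) z| / √T := by
  rw [abs_mul, abs_mul, abs_of_nonneg (heatFlux_nonneg (by positivity)),
    abs_of_nonneg (heatKernel_nonneg _ _), mul_div_assoc]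
  gcongr
  exact (heatFlux_le_heatKernel_two_mul hT _).trans
    (by gcongr; exact heatKernel_add_abs_le hx _ _)

theorem hittingFlux_le (hT : 0 < T) (hf : MemLp f 2) (hx : 0 ≤ x) :
    hittingFlux T R f x ≤ ∫ y, |f y * heatKernel (2 * T) (R - y)| / √T :=
  (Real.le_norm_self _).trans <| norm_integral_le_of_norm_le
    ((integrable_mul_heatKernel_sub (2 * T) R hf).abs.div_const _)
    (.of_forall fun y => abs_mul_heatFlux_add_abs_le hT hx (f y) (R - y))

theorem continuousOn_hittingFlux (hT : 0 < T) (hf : MemLp f 2) :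
    ContinuousOn (hittingFlux T R f) (Ici 0) :=
  continuousOn_of_dominated
    (fun x _ => hf.aestronglyMeasurable.mul
      (measurable_heatFlux_comp (by fun_prop) (by fun_prop)).aestronglyMeasurable)
    (fun x hx => .of_forall fun y => abs_mul_heatFlux_add_abs_le hT hx (f y) (R - y))
    ((integrable_mul_heatKernel_sub (2 * T) R hf).abs.div_const _)
    (.of_forall fun y => (continuous_const.mul
      ((continuous_heatFlux T).comp (continuous_id.add_const _))).continuousOn)

theorem hasDerivAt_hittingFlow (hT : 0 < T) (hf : MemLp f 2) (hx : 0 < x) :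
    HasDerivAt (hittingFlow T R f) (-hittingFlux T R f x) x :=
  hasDerivAt_integral_mul_heatKernel hf.aestronglyMeasurable measurable_const (by fun_prop) hx
    (integrable_mul_heatKernel_add_abs_sub T R hf hx.le)
    (.of_forall fun y _ hx => abs_mul_heatFlux_add_abs_le hT (le_of_lt hx) (f y) (R - y))
    ((integrable_mul_heatKernel_sub (2 * T) R hf).abs.div_const _)

theorem integral_hittingFlux (hT : 0 < T) (hR : 0 ≤ R) (hf : MemLp f 2) (hx : 0 < x) :
    ∫ y in x..x + R, hittingFlux T R f y = hittingFlow T R f x - hittingFlow T R f (x + R) := by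
  have hpos : ∀ y ∈ uIcc x (x + R), 0 < y := fun y hy =>
    hx.trans_le (uIcc_of_le (le_add_of_nonneg_right hR) ▸ hy).1
  have hint : IntervalIntegrable (hittingFlux T R f) volume x (x + R) :=
    ((continuousOn_hittingFlux hT hf).mono fun y hy => (hpos y hy).le).intervalIntegrable
  have h := intervalIntegral.integral_eq_sub_of_hasDerivAt
    (fun y hy => hasDerivAt_hittingFlow (R := R) hT hf (hpos y hy)) hint.neg
  rw [← neg_sub, ← h, intervalIntegral.integral_neg, neg_neg]

theorem hittingFlow_comp_neg_add_le (hf : MemLp f 2) (hf0 : ∀ y, 0 ≤ f y) (hR : 0 ≤ R)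
    (hsymm : ∀ y ∉ Ioo (-(R / 2)) (R / 2), f (-y) = f y) (hx : 0 ≤ x) :
    hittingFlow T R (fun y => f (-y)) (x + R) ≤ hittingFlow T R f x := by
  set g : ℝ → ℝ := fun y =>
    f y * heatKernel T (x + |R - y|) - f y * heatKernel T (x + R + |R - -y|) with hg
  have hf_neg : MemLp (fun y => f (-y)) 2 :=
    hf.comp_measurePreserving (Measure.measurePreserving_neg volume)
  have hint := integrable_mul_heatKernel_add_abs_sub T R hf hx
  have hint' := (integrable_mul_heatKernel_add_abs_sub T R hf_neg (add_nonneg hx hR)).comp_neg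
  simp only [neg_neg] at hint'
  have hg_int : Integrable g := hint.sub hint'
  have hK {y z : ℝ} (h : |y| ≤ R + |z|) : heatKernel T (x + R + |z|) ≤ heatKernel T (x + |y|) :=
    heatKernel_le_of_le (by positivity) (by linarith)
  have hg_near {y : ℝ} (hy : -(R / 2) < y) : 0 ≤ g y := by
    refine sub_nonneg.2 (mul_le_mul_of_nonneg_left (hK ?_) (hf0 y))
    exact abs_le.2 ⟨by linarith [le_abs_self (R - -y)], by linarith [le_abs_self (R - -y)]⟩
  have hg_symm (y : ℝ) : 0 ≤ g y + g (-y) := by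
    by_cases hy : y ∈ Ioo (-(R / 2)) (R / 2)
    · exact add_nonneg (hg_near hy.1) (hg_near (neg_lt_neg hy.2))
    · have h₁ := mul_le_mul_of_nonneg_left (hK (le_add_of_nonneg_left hR : |R - y| ≤ _)) (hf0 y)
      have h₂ := mul_le_mul_of_nonneg_left (hK (le_add_of_nonneg_left hR : |R - -y| ≤ _)) (hf0 y)
      simp only [hg, hsymm y hy, neg_neg]
      linarith
  have hg_integral : 0 ≤ ∫ y, g y := by
    have h : 0 ≤ ∫ y, (g y + g (-y)) := integral_nonneg hg_symm
    rw [integral_add hg_int hg_int.comp_neg, integral_neg_eq_self] at h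
    linarith
  rw [hg, integral_sub hint hint', sub_nonneg] at hg_integral
  refine le_of_eq_of_le ?_ hg_integral
  rw [hittingFlow, ← integral_neg_eq_self]
  simp only [neg_neg]

end HittingFlow

/-- The contribution at time `t` and position `x` of a point source of intensity `Ψ` at the
origin. -/
noncomputable def duhamel (D : ℝ) (Ψ : ℝ → ℝ) (t x : ℝ) : ℝ :=
  ∫ τ in Ioc 0 t, Ψ τ * heatKernel (D * (t - τ)) x

/-- The solution of `∂ₜ v = D ∂ₓ² v + Ψ δ₀` with initial value `f`. -/
noncomputable def sourceSolution (D : ℝ) (f Ψ : ℝ → ℝ) (t x : ℝ) : ℝ :=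
  heatFlow (D * t) f x + duhamel D Ψ t x

/-- The part of the solution with initial value `f` and source `Ψ δ₀` which has travelled through
the point `R`, at distance `x` beyond `R`. All heat emitted at the origin belongs to this part. -/
noncomputable def throughSolution (D R : ℝ) (f Ψ : ℝ → ℝ) (t x : ℝ) : ℝ :=
  hittingFlow (D * t) R f x + duhamel D Ψ t (R + x)

section SourceSolution

variable {D R a t r s x : ℝ} {f Ψ : ℝ → ℝ}

theorem heatFlow_comp_neg (s : ℝ) (f : ℝ → ℝ) (x : ℝ) :
    heatFlow s (fun y => f (-y)) x = heatFlow s f (-x) := by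
  rw [heatFlow, ← integral_neg_eq_self, heatFlow]
  refine integral_congr_ae (.of_forall fun y => ?_)
  simp only [neg_neg]
  rw [← heatKernel_neg s (x - -y), neg_sub, neg_sub_comm]

theorem duhamel_neg (D : ℝ) (Ψ : ℝ → ℝ) (t x : ℝ) : duhamel D Ψ t (-x) = duhamel D Ψ t x := by
  simp only [duhamel, heatKernel_neg]

theorem sourceSolution_comp_neg (D : ℝ) (f Ψ : ℝ → ℝ) (t x : ℝ) :
    sourceSolution D (fun y => f (-y)) Ψ t x = sourceSolution D f Ψ t (-x) := by
  rw [sourceSolution, sourceSolution, heatFlow_comp_neg, duhamel_neg]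

theorem ae_mem_Ico_of_restrict_Ioc (a b : ℝ) :
    ∀ᵐ τ ∂volume.restrict (Ioc a b), τ ∈ Ico a b := by
  rw [← restrict_Ico_eq_restrict_Ioc]
  exact ae_restrict_mem measurableSet_Ico

theorem norm_mul_heatKernel_le (hD : 0 ≤ D) (hr : 0 < r) (hx : r ≤ x) {τ : ℝ} (hτ : 0 ≤ τ) (c : ℝ) :
    ‖c * heatKernel (D * (t - τ)) x‖ ≤ |c| * (4 * √(D * t) / r ^ 2) := by
  rw [norm_mul, Real.norm_of_nonneg (heatKernel_nonneg _ _), Real.norm_eq_abs]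
  gcongr
  exact heatKernel_le hr hx (by gcongr; linarith)

theorem integrableOn_mul_heatKernel (hD : 0 ≤ D) (hΨ : IntegrableOn Ψ (Ioc 0 t)) (hx : 0 < x) :
    IntegrableOn (fun τ => Ψ τ * heatKernel (D * (t - τ)) x) (Ioc 0 t) := by
  refine (hΨ.abs.mul_const (4 * √(D * t) / x ^ 2)).mono' (hΨ.aestronglyMeasurable.mul
    (measurable_heatKernel_comp (by fun_prop) (by fun_prop)).aestronglyMeasurable) ?_
  filter_upwards [ae_restrict_mem measurableSet_Ioc] with τ hτ
  exact norm_mul_heatKernel_le hD hx le_rfl hτ.1.le _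

theorem abs_duhamel_le (hD : 0 ≤ D) (hΨ : IntegrableOn Ψ (Ioc 0 t)) (hr : 0 < r) (hx : r ≤ x) :
    |duhamel D Ψ t x| ≤ ∫ τ in Ioc 0 t, |Ψ τ| * (4 * √(D * t) / r ^ 2) := by
  rw [← Real.norm_eq_abs]
  refine norm_integral_le_of_norm_le (hΨ.abs.mul_const _) ?_
  filter_upwards [ae_restrict_mem measurableSet_Ioc] with τ hτ
  exact norm_mul_heatKernel_le hD hr hx hτ.1.le _

theorem hasDerivAt_duhamel (hD : 0 < D) (hΨ : IntegrableOn Ψ (Ioc 0 t)) (hR : 0 < R)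
    (hx : 0 < x) :
    HasDerivAt (fun x => duhamel D Ψ t (R + x))
      (-(∫ s in Ioc 0 t, firstPassageDensity D (t - s) (R + x) * Ψ s) / (2 * D)) x := by
  have hbound : ∀ᵐ τ ∂volume.restrict (Ioc 0 t), ∀ y ∈ Ioi 0,
      |Ψ τ * heatFlux (D * (t - τ)) (y + R)| ≤ |Ψ τ| * (16 * √(D * t) / R ^ 3) := by
    filter_upwards [ae_restrict_mem measurableSet_Ioc] with τ hτ y hy
    have hyR : R ≤ y + R := le_add_of_nonneg_left (le_of_lt hy)
    rw [abs_mul, abs_of_nonneg (heatFlux_nonneg (hR.le.trans hyR))]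
    gcongr
    exact heatFlux_le hR hyR (by gcongr; linarith [hτ.1])
  have h := hasDerivAt_integral_mul_heatKernel (s := fun τ => D * (t - τ)) (z := fun _ => R)
    hΨ.aestronglyMeasurable (by fun_prop) measurable_const hx
    (integrableOn_mul_heatKernel hD.le hΨ (add_pos hx hR)) hbound (hΨ.abs.mul_const _)
  simp only [duhamel, add_comm R]
  refine h.congr_deriv ?_
  rw [neg_div, ← integral_div]
  congr 2 with τ
  rw [firstPassageDensity]
  field_simp

theorem setIntegral_mul_heatKernel_eq_duhamel (hD : 0 ≤ D) (hs : s ≤ t) (Ψ : ℝ → ℝ) (x : ℝ) :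
    ∫ τ in Ioc 0 t, Ψ τ * heatKernel (D * (s - τ)) x = duhamel D Ψ s x :=
  setIntegral_eq_of_subset_of_forall_sdiff_eq_zero measurableSet_Ioc (Ioc_subset_Ioc_right hs)
    fun τ hτ => by
      have hsτ : s ≤ τ := not_lt.1 fun h => hτ.2 ⟨hτ.1.1, h.le⟩
      rw [heatKernel_of_nonpos (mul_nonpos_of_nonneg_of_nonpos hD (sub_nonpos.2 hsτ)), mul_zero]

theorem integral_firstPassageDensity_mul_heatFlow (hD : 0 < D) (ht : 0 < t) (hx : 0 < x)
    (R : ℝ) (hf : MemLp f 2) :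
    IntegrableOn (fun s => firstPassageDensity D (t - s) x * heatFlow (D * s) f R) (Ioc 0 t) ∧
    ∫ s in Ioc 0 t, firstPassageDensity D (t - s) x * heatFlow (D * s) f R =
      hittingFlow (D * t) R f x := by
  have hne : ∀ᵐ y : ℝ, (0 : ℝ) ∈ Ico 0 t ∧ R - y ≠ 0 := by
    filter_upwards [Measure.ae_ne volume R] with y hy
    exact ⟨⟨le_rfl, ht⟩, sub_ne_zero.2 hy.symm⟩
  have hint : Integrable fun y => f y * heatKernel (D * (t - 0)) (x + |R - y|) :=
    integrable_mul_heatKernel_add_abs_sub _ R hf hx.le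
  have h₁ := integrableOn_firstPassageDensity_mul_integral hD hx hf.aestronglyMeasurable
    measurable_const (by fun_prop) hne hint
  have h₂ := setIntegral_firstPassageDensity_mul_integral hD hx hf.aestronglyMeasurable
    measurable_const (by fun_prop) hne hint
  simp only [sub_zero, ← mul_comm (heatKernel _ (R - _))] at h₁ h₂
  exact ⟨h₁, h₂⟩

theorem integral_firstPassageDensity_mul_duhamel (hD : 0 < D) (hR : 0 < R) (hx : 0 < x)
    (hΨ : IntegrableOn Ψ (Ioc 0 t)) :
    IntegrableOn (fun s => firstPassageDensity D (t - s) x * duhamel D Ψ s R) (Ioc 0 t) ∧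
    ∫ s in Ioc 0 t, firstPassageDensity D (t - s) x * duhamel D Ψ s R =
      duhamel D Ψ t (R + x) := by
  have hne : ∀ᵐ τ ∂volume.restrict (Ioc 0 t), τ ∈ Ico 0 t ∧ R ≠ 0 :=
    (ae_mem_Ico_of_restrict_Ioc 0 t).mono fun τ hτ => ⟨hτ, hR.ne'⟩
  have hint : IntegrableOn (fun τ => Ψ τ * heatKernel (D * (t - τ)) (x + |R|)) (Ioc 0 t) :=
    integrableOn_mul_heatKernel hD.le hΨ (by positivity)
  have h₁ := integrableOn_firstPassageDensity_mul_integral hD hx hΨ.aestronglyMeasurable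
    measurable_id measurable_const hne hint
  have h₂ := setIntegral_firstPassageDensity_mul_integral hD hx hΨ.aestronglyMeasurable
    measurable_id measurable_const hne hint
  have hcongr : EqOn (fun s => firstPassageDensity D (t - s) x *
      ∫ τ in Ioc 0 t, Ψ τ * heatKernel (D * (s - τ)) R)
      (fun s => firstPassageDensity D (t - s) x * duhamel D Ψ s R) (Ioc 0 t) := fun s hs => by
    simp only [setIntegral_mul_heatKernel_eq_duhamel hD.le hs.2]
  refine ⟨h₁.congr_fun hcongr measurableSet_Ioc, ?_⟩
  rw [← setIntegral_congr_fun measurableSet_Ioc hcongr, add_comm R, duhamel]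
  simpa only [id, abs_of_pos hR] using h₂

theorem integral_firstPassageDensity_mul_sourceSolution (hD : 0 < D) (hR : 0 < R) (ht : 0 < t)
    (hf : MemLp f 2) (hΨ : IntegrableOn Ψ (Ioc 0 t)) (hx : 0 < x) :
    IntegrableOn (fun s => firstPassageDensity D (t - s) x * sourceSolution D f Ψ s R) (Ioc 0 t) ∧
    ∫ s in Ioc 0 t, firstPassageDensity D (t - s) x * sourceSolution D f Ψ s R =
      throughSolution D R f Ψ t x := by
  obtain ⟨hf_int, hf_eq⟩ := integral_firstPassageDensity_mul_heatFlow hD ht hx R hf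
  obtain ⟨hΨ_int, hΨ_eq⟩ := integral_firstPassageDensity_mul_duhamel hD hR hx hΨ
  simp only [sourceSolution, mul_add]
  exact ⟨hf_int.add hΨ_int, by rw [integral_add hf_int hΨ_int, hf_eq, hΨ_eq, throughSolution]⟩

theorem throughSolution_le_sourceSolution (hf : MemLp f 2) (hf0 : ∀ y, 0 ≤ f y) (hx : 0 ≤ x) :
    throughSolution D R f Ψ t x ≤ sourceSolution D f Ψ t (R + x) := by
  unfold throughSolution sourceSolution
  gcongr
  exact add_comm x R ▸ hittingFlow_le_heatFlow hf hf0 hx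

theorem throughSolution_comp_neg_le (hR : 0 < R) (hDt : 0 < D * t) (hf : MemLp f 2)
    (hf0 : ∀ y, 0 ≤ f y) (hsymm : ∀ y ∉ Ioo (-(R / 2)) (R / 2), f (-y) = f y) (hx : 0 < x) :
    throughSolution D R (fun y => f (-y)) Ψ t (x + R) ≤
      throughSolution D R f Ψ t (x + R) + ∫ y in x..x + R, hittingFlux (D * t) R f y := by
  rw [integral_hittingFlux hDt hR.le hf hx, throughSolution, throughSolution]
  linarith [hittingFlow_comp_neg_add_le (T := D * t) hf hf0 hR.le hsymm hx.le]

theorem abs_throughSolution_le (hD : 0 ≤ D) (hR : 0 < R) (hf : MemLp f 2) (hf0 : ∀ y, 0 ≤ f y)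
    (hΨ : IntegrableOn Ψ (Ioc 0 t)) (hx : 0 ≤ x) :
    |throughSolution D R f Ψ t x| ≤ (∫ y, f y * heatKernel (D * t) (R - y)) +
      ∫ τ in Ioc 0 t, |Ψ τ| * (4 * √(D * t) / R ^ 2) := by
  refine (abs_add_le _ _).trans (add_le_add ?_ ?_)
  · rw [abs_of_nonneg (hittingFlow_nonneg hf0 x)]
    exact hittingFlow_le hf hf0 hx
  · exact abs_duhamel_le hD hΨ hR (le_add_of_nonneg_right hx)

theorem hasDerivAt_throughSolution (hD : 0 < D) (ht : 0 < t) (hR : 0 < R) (hf : MemLp f 2)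
    (hΨ : IntegrableOn Ψ (Ioc 0 t)) (hx : 0 < x) :
    HasDerivAt (throughSolution D R f Ψ t) (-hittingFlux (D * t) R f x +
      -(∫ s in Ioc 0 t, firstPassageDensity D (t - s) (R + x) * Ψ s) / (2 * D)) x :=
  (hasDerivAt_hittingFlow (mul_pos hD ht) hf hx).add (hasDerivAt_duhamel hD hΨ hR hx)

theorem integrableOn_firstPassageDensity_mul (hD : 0 ≤ D) (hΨ : IntegrableOn Ψ (Ioc 0 t))
    (hx : 0 < x) : IntegrableOn (fun s => firstPassageDensity D (t - s) x * Ψ s) (Ioc 0 t) := by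
  refine hΨ.bdd_mul (c := 2 * D * (16 * √(D * t) / x ^ 3))
    ((measurable_heatFlux_comp (by fun_prop) (by fun_prop)).const_mul (2 * D)).aestronglyMeasurable
    ?_
  filter_upwards [ae_restrict_mem measurableSet_Ioc] with s hs
  rw [Real.norm_of_nonneg (firstPassageDensity_nonneg hD hx.le _), firstPassageDensity]
  gcongr
  exact heatFlux_le hx le_rfl (by gcongr; linarith [hs.1])

theorem neg_integral_firstPassageDensity_mul_le (hD : 0 < D) (hR : 0 < R) (ht : 0 < t)
    (hf : MemLp f 2) (hΨ : IntegrableOn Ψ (Ioc 0 t))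
    (hlow : ∀ᵐ s ∂volume.restrict (Ioc 0 t),
      -(a * (sourceSolution D f Ψ s (-R) + sourceSolution D f Ψ s R)) ≤ Ψ s) (hx : 0 < x) :
    -∫ s in Ioc 0 t, firstPassageDensity D (t - s) x * Ψ s ≤
      a * (throughSolution D R (fun y => f (-y)) Ψ t x + throughSolution D R f Ψ t x) := by
  have hf_neg : MemLp (fun y => f (-y)) 2 :=
    hf.comp_measurePreserving (Measure.measurePreserving_neg volume)
  obtain ⟨hint, heq⟩ :=
    integral_firstPassageDensity_mul_sourceSolution hD hR ht hf hΨ hx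
  obtain ⟨hint', heq'⟩ :=
    integral_firstPassageDensity_mul_sourceSolution hD hR ht hf_neg hΨ hx
  rw [← heq, ← heq', ← integral_add hint' hint, ← integral_const_mul, ← integral_neg]
  refine integral_mono_ae (integrableOn_firstPassageDensity_mul hD.le hΨ hx).neg
    ((hint'.add hint).const_mul a) ?_
  filter_upwards [hlow] with s hs
  simp only [sourceSolution_comp_neg]
  linarith [mul_le_mul_of_nonneg_left hs (firstPassageDensity_nonneg hD.le hx.le (t - s))]

theorem throughSolution_nonneg (hD : 0 < D) (hR : 0 < R) (ht : 0 < t)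
    (ha : a * R / D ∈ Ioc 0 (Real.exp (-1))) (hf : MemLp f 2) (hf0 : ∀ y, 0 ≤ f y)
    (hsymm : ∀ y ∉ Ioo (-(R / 2)) (R / 2), f (-y) = f y) (hΨ : IntegrableOn Ψ (Ioc 0 t))
    (hlow : ∀ᵐ s ∂volume.restrict (Ioc 0 t),
      -(a * (sourceSolution D f Ψ s (-R) + sourceSolution D f Ψ s R)) ≤ Ψ s) (hx : 0 < x) :
    0 ≤ throughSolution D R f Ψ t x := by
  have hDt : 0 < D * t := mul_pos hD ht
  have ha0 : 0 < a := (mul_pos_iff_of_pos_right hR).1 ((div_pos_iff_of_pos_right hD).1 ha.1)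
  obtain ⟨l, hl, hlR, hlc⟩ :=
    exists_delay_characteristic_root hR ((div_mul_eq_mul_div a D R).symm ▸ ha)
  refine nonneg_of_advanced_deriv_le hl hR.le (by linarith)
    (fun y hy => hasDerivAt_throughSolution hD ht hR hf hΨ hy)
    (fun y hy => (abs_throughSolution_le hD.le hR hf hf0 hΨ (le_of_lt hy)).trans (le_max_left _ _))
    ((continuousOn_hittingFlux (R := R) hDt hf).mono Ioi_subset_Ici_self)
    (fun y hy => hittingFlux_nonneg hf0 (le_of_lt hy))
    (fun y hy => (hittingFlux_le hDt hf (le_of_lt hy)).trans (le_max_right _ _))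
    (fun y hy => ?_) hx
  have hsource := neg_integral_firstPassageDensity_mul_le hD hR ht hf hΨ hlow (add_pos hy hR)
  have hreflect := throughSolution_comp_neg_le (Ψ := Ψ) hR hDt hf hf0 hsymm hy
  rw [← hlc, add_comm R y, sub_eq_neg_add]
  gcongr
  calc -(∫ s in Ioc 0 t, firstPassageDensity D (t - s) (y + R) * Ψ s) / (2 * D)
      ≤ a * (throughSolution D R (fun y => f (-y)) Ψ t (y + R) +
          throughSolution D R f Ψ t (y + R)) / (2 * D) := by gcongr
    _ ≤ a * (throughSolution D R f Ψ t (y + R) + (∫ z in y..y + R, hittingFlux (D * t) R f z) +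
          throughSolution D R f Ψ t (y + R)) / (2 * D) := by gcongr
    _ = a / D * (throughSolution D R f Ψ t (y + R) +
          (∫ z in y..y + R, hittingFlux (D * t) R f z) / 2) := by field_simp; ring

theorem sourceSolution_nonneg (hD : 0 < D) (hR : 0 < R) (ht : 0 < t)
    (ha : a * R / D ∈ Ioc 0 (Real.exp (-1))) (hf : MemLp f 2) (hf0 : ∀ y, 0 ≤ f y)
    (hsymm : ∀ y ∉ Ioo (-(R / 2)) (R / 2), f (-y) = f y) (hΨ : IntegrableOn Ψ (Ioc 0 t))
    (hlow : ∀ᵐ s ∂volume.restrict (Ioc 0 t),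
      -(a * (sourceSolution D f Ψ s (-R) + sourceSolution D f Ψ s R)) ≤ Ψ s) (hx : R < x) :
    0 ≤ sourceSolution D f Ψ t x := by
  rw [← add_sub_cancel R x]
  exact (throughSolution_nonneg hD hR ht ha hf hf0 hsymm hΨ hlow (sub_pos.2 hx)).trans
    (throughSolution_le_sourceSolution hf hf0 (sub_pos.2 hx).le)

theorem sourceSolution_nonneg_of_lt_abs (hD : 0 < D) (hR : 0 < R) (ht : 0 < t)
    (ha : a * R / D ∈ Ioc 0 (Real.exp (-1))) (hf : MemLp f 2) (hf0 : ∀ y, 0 ≤ f y)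
    (hsymm : ∀ y ∉ Ioo (-(R / 2)) (R / 2), f (-y) = f y) (hΨ : IntegrableOn Ψ (Ioc 0 t))
    (hlow : ∀ᵐ s ∂volume.restrict (Ioc 0 t),
      -(a * (sourceSolution D f Ψ s (-R) + sourceSolution D f Ψ s R)) ≤ Ψ s) (hx : R < |x|) :
    0 ≤ sourceSolution D f Ψ t x := by
  rcases lt_abs.1 hx with hx | hx
  · exact sourceSolution_nonneg hD hR ht ha hf hf0 hsymm hΨ hlow hx
  · have h := sourceSolution_nonneg hD hR ht ha (f := fun y => f (-y))
      (hf.comp_measurePreserving (Measure.measurePreserving_neg volume)) (fun y => hf0 (-y))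
      (fun y hy => (neg_neg y).symm ▸ (hsymm y hy).symm) hΨ
      (by simpa only [sourceSolution_comp_neg, neg_neg, add_comm] using hlow) hx
    rwa [sourceSolution_comp_neg, neg_neg] at h

end SourceSolution

theorem continuous_integral_add_mul {f g : ℝ → ℝ} (hf : MemLp f 2) (hg : MemLp g 2) :
    Continuous fun x => ∫ y, g (x + y) * f y := by
  have : Fact ((2 : ℝ≥0∞) ≠ ⊤) := ⟨ENNReal.ofNat_ne_top⟩
  have htranslate : Continuous fun x : ℝ => DomAddAct.mk x +ᵥ hg.toLp g :=
    DomAddAct.continuous_mk.vadd continuous_const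
  refine (continuous_const.inner (f := fun _ => hf.toLp f) htranslate).congr fun x => ?_
  rw [lp_inner_toLp, DomAddAct.mk_vadd_toLp]
  refine integral_congr_ae ?_
  have hcomp := hg.comp_measurePreserving (measurePreserving_vadd x volume)
  exact hcomp.coeFn_toLp.mono fun y hy => congrArg (· * f y) hy

theorem continuous_heatFlow (s : ℝ) {f : ℝ → ℝ} (hf : MemLp f 2) : Continuous (heatFlow s f) := by
  have h := (continuous_integral_add_mul hf (memLp_heatKernel s)).comp continuous_neg
  refine h.congr fun x => ?_
  simp only [Function.comp, heatFlow, ← heatKernel_neg s (x - _), neg_sub, neg_add_eq_sub]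

theorem H1.rep_eq_of_ae_eq {f : H1} {F : ℝ → ℝ} (hF : Continuous F) (h : f.rep =ᵐ[volume] F) :
    f.rep = F :=
  (Continuous.ae_eq_iff_eq volume f.continuous_rep hF).1 h

theorem H1.memLp_rep (f : H1) : MemLp f.rep 2 :=
  (Lp.memLp f.1.fst).ae_eq f.coeFn_ae_eq_rep

theorem exists_continuousLinearMap_eq_of_tendsto {E α : Type*} [NormedAddCommGroup E]
    [NormedSpace ℝ E] [CompleteSpace E] {l : Filter α} [l.IsCountablyGenerated] [l.NeBot]
    {g : α → E →L[ℝ] ℝ} {f : E → ℝ} (h : ∀ x, Tendsto (fun n => g n x) l (𝓝 (f x))) :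
    ∃ L : E →L[ℝ] ℝ, ∀ x, L x = f x :=
  ⟨continuousLinearMapOfTendsto g (tendsto_pi_nhds.2 h), fun _ => rfl⟩

theorem H1.exists_continuousLinearMap_eq_rep (x : ℝ) :
    ∃ L : H1 →L[ℝ] ℝ, ∀ f : H1, L f = f.rep x := by
  let average (h : ℝ) : H1 →L[ℝ] ℝ := h⁻¹ • (innerSL ℝ
    (indicatorConstLp 2 (measurableSet_Ioc (a := x) (b := x + h)) (by simp) (1 : ℝ)) ∘L
      WithLp.fstL 2 ℝ _ _ ∘L sobolevH1.subtypeL)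
  refine exists_continuousLinearMap_eq_of_tendsto (l := 𝓝[>] 0) (g := average) fun f => ?_
  have hderiv : HasDerivAt (fun y => ∫ z in x..y, f.rep z) (f.rep x) x :=
    (f.continuous_rep.integral_hasStrictDerivAt x x).hasDerivAt
  refine hderiv.tendsto_slope_zero_right.congr' ?_
  filter_upwards [self_mem_nhdsWithin] with h hh
  have happly : average h f = h⁻¹ • inner ℝ (indicatorConstLp 2
    (measurableSet_Ioc (a := x) (b := x + h)) (by simp) (1 : ℝ)) f.1.fst := rfl
  rw [happly, L2.inner_indicatorConstLp_one, intervalIntegral.integral_same, sub_zero,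
    intervalIntegral.integral_of_le (le_add_of_nonneg_right (le_of_lt hh))]
  congr 1
  exact integral_congr_ae (ae_restrict_of_ae f.coeFn_ae_eq_rep.symm)

theorem H1.rep_smul (c : ℝ) (f : H1) (x : ℝ) : (c • f).rep x = c * f.rep x := by
  obtain ⟨L, hL⟩ := H1.exists_continuousLinearMap_eq_rep x
  rw [← hL, map_smul, hL, smul_eq_mul]

theorem rep_heatKernelH1 (s : ℝ) : (heatKernelH1 s).rep = heatKernel s :=
  H1.rep_eq_of_ae_eq (continuous_heatKernel s)
    ((heatKernelH1 s).coeFn_ae_eq_rep.symm.trans (memLp_heatKernel s).coeFn_toLp)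

namespace IsMildSolution

variable {D R a t : ℝ} {Φ : ℝ → ℝ} {u₀ : H1} {u : ℝ → H1}

theorem rep_apply (hu : IsMildSolution D R a Φ u₀ u) (ht : 0 < t) (x : ℝ) :
    (u t).rep x = sourceSolution D u₀.rep (fun τ => feedback R a Φ τ (u τ)) t x := by
  rw [H1.rep_eq_of_ae_eq ((continuous_heatFlow _ u₀.memLp_rep).add (H1.continuous_rep _))
    (hu.variation_of_constants t ht), Pi.add_apply, sourceSolution, duhamel]
  obtain ⟨L, hL⟩ := H1.exists_continuousLinearMap_eq_rep x
  rw [← hL, ← L.intervalIntegral_comp_comm (hu.integrable t ht),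
    intervalIntegral.integral_of_le ht.le]
  simp only [hL, H1.rep_smul, rep_heatKernelH1]

theorem integrableOn_feedback (hD : 0 < D) (hu : IsMildSolution D R a Φ u₀ u) (ht : 0 < t) :
    IntegrableOn (fun τ => feedback R a Φ τ (u τ)) (Ioc 0 t) := by
  obtain ⟨L, hL⟩ := H1.exists_continuousLinearMap_eq_rep 0
  have hint : IntegrableOn (fun τ => feedback R a Φ τ (u τ) * heatKernel (D * (t - τ)) 0)
      (Ioc 0 t) := by
    simpa only [IntegrableOn, hL, H1.rep_smul, rep_heatKernelH1]
      using L.integrable_comp ((intervalIntegrable_iff_integrableOn_Ioc_of_le ht.le).1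
        (hu.integrable t ht))
  have hinv : ∀ᵐ τ ∂volume.restrict (Ioc 0 t), √(4 * Real.pi * (D * (t - τ))) *
      (feedback R a Φ τ (u τ) * heatKernel (D * (t - τ)) 0) = feedback R a Φ τ (u τ) := by
    filter_upwards [ae_mem_Ico_of_restrict_Ioc 0 t] with τ hτ
    have hτt : 0 < t - τ := sub_pos.2 hτ.2
    have hsqrt : √(4 * Real.pi * (D * (t - τ))) ≠ 0 := (Real.sqrt_pos.2 (by positivity)).ne'
    rw [heatKernel, zero_pow two_ne_zero, neg_zero, zero_div, Real.exp_zero, mul_one_div,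
      mul_div_cancel₀ _ hsqrt]
  refine (hint.bdd_mul (c := √(4 * Real.pi * (D * t))) (by fun_prop) ?_).congr hinv
  filter_upwards [ae_restrict_mem measurableSet_Ioc] with τ hτ
  rw [Real.norm_of_nonneg (Real.sqrt_nonneg _)]
  gcongr
  linarith [hτ.1]

theorem neg_mul_sourceSolution_add_le_feedback (hu : IsMildSolution D R a Φ u₀ u)
    (hΦ0 : ∀ᵐ t ∂volume.restrict (Ici 0), 0 ≤ Φ t) :
    ∀ᵐ s ∂volume.restrict (Ioc 0 t),
      -(a * (sourceSolution D u₀.rep (fun τ => feedback R a Φ τ (u τ)) s (-R) +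
        sourceSolution D u₀.rep (fun τ => feedback R a Φ τ (u τ)) s R)) ≤
      feedback R a Φ s (u s) := by
  filter_upwards [ae_restrict_of_ae_restrict_of_subset (fun s hs => le_of_lt hs.1) hΦ0,
    ae_restrict_mem measurableSet_Ioc] with s hs hst
  rw [← hu.rep_apply hst.1, ← hu.rep_apply hst.1, feedback]
  linarith

end IsMildSolution

theorem mem_closure_lt_abs {R x : ℝ} (hR : 0 < R) (hx : x ∉ Ioo (-R) R) :
    x ∈ closure {y : ℝ | R < |y|} := by
  have hRx : R ≤ |x| := not_lt.1 fun h => hx (abs_lt.1 h)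
  refine mem_closure_of_tendsto (f := fun c : ℝ => c * x) (b := 𝓝[>] 1) ?_ ?_
  · exact tendsto_nhdsWithin_of_tendsto_nhds (Continuous.tendsto' (by fun_prop) _ _ (one_mul x))
  · filter_upwards [self_mem_nhdsWithin] with c hc
    have hc : 1 < c := hc
    change R < |c * x|
    rw [abs_mul, abs_of_pos (one_pos.trans hc)]
    exact hRx.trans_lt (lt_mul_of_one_lt_left (hR.trans_le hRx) hc)

theorem proposition2p4_general
    (D R a : ℝ) (hD : 0 < D) (hR : 0 < R)
    (ha : a * R / D ∈ Set.Ioc 0 (Real.exp (-1)))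
    (Φ : ℝ → ℝ) (hΦ0 : ∀ᵐ t ∂(MeasureTheory.volume.restrict (Set.Ici (0 : ℝ))), 0 ≤ Φ t)
    (u₀ : H1) (hu₀ : ∀ x, 0 ≤ u₀.rep x)
    (hsymm : ∀ x ∉ Set.Ioo (-(R / 2)) (R / 2), u₀.rep (-x) = u₀.rep x)
    (u : ℝ → H1) (hu : IsMildSolution D R a Φ u₀ u) :
    ∀ t, 0 ≤ t → ∀ x ∉ Set.Ioo (-R) R, 0 ≤ (u t).rep x := by
  intro t ht x hx
  rcases ht.eq_or_lt with rfl | ht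
  · exact hu.initial ▸ hu₀ x
  have hoff : ∀ y, R < |y| → 0 ≤ (u t).rep y := fun y hy => by
    rw [hu.rep_apply ht]
    exact sourceSolution_nonneg_of_lt_abs hD hR ht ha u₀.memLp_rep hu₀ hsymm
      (hu.integrableOn_feedback hD ht) (hu.neg_mul_sourceSolution_add_le_feedback hΦ0) hy
  exact closure_minimal hoff (isClosed_Ici.preimage (u t).continuous_rep)
    (mem_closure_lt_abs hR hx)

theorem proposition2p4
    (D R a : ℝ) (hD : 0 < D) (hR : 0 < R)
    (ha : a * R / D ∈ Set.Ioc 0 (Real.exp (-1)))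
    (Φ : ℝ → ℝ) (hΦ : IsLocallyBounded Φ) (hΦexp : IsExponentialOrder Φ)
    (hΦ0 : ∀ᵐ t ∂(MeasureTheory.volume.restrict (Set.Ici (0 : ℝ))), 0 ≤ Φ t)
    (u₀ : H1) (hu₀ : ∀ x, 0 ≤ u₀.rep x)
    (hsymm : ∀ x ∉ Set.Ioo (-(R / 2)) (R / 2), u₀.rep (-x) = u₀.rep x)
    (u : ℝ → H1) (hu : IsMildSolution D R a Φ u₀ u) :
    ∀ t, 0 ≤ t → ∀ x ∉ Set.Ioo (-R) R, 0 ≤ (u t).rep x :=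
  proposition2p4_general D R a hD hR ha Φ hΦ0 u₀ hu₀ hsymm u hu
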